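/- Let $\mathbb N=\{1,2,3,\dots\}$. For $i<j$ let $(ij)$ and $(ij)_-$ be the linear maps of $\mathbb R^{\mathbb N}$ that replace the coordinates $(x_i,x_j)$ by $(x_j,x_i)$ and by $(-x_j,-x_i)$, respectively; these are reflections in the hyperplanes $x_i=x_j$ and $x_i=-x_j$. Let $\mathcal D$ be the group generated by all of them and $\mathcal D_+$ the subgroup generated by the $(ij)$. Put $v_-=(-1,-2,-3,\dots)$. Let $C'$ be the set of points that lie strictly on the same side as $v_-$ of each of these hyperplanes, and let $C_0\supset C'$ be the chamber of $\mathcal D_+$ consisting of the strictly descending sequences. An alcove is a set $wC'$ with $w\in\mathcal D$; it is dominant if it lies in $C_0$; its length $l(A)$ is the number of hyperplanes that separate $A$ from $C'$. Let $G$ be the directed graph whose vertices are the dominant alcoves, with an edge $(A,B)$ if $B=tA$ for a reflection $t$ whose hyperplane makes a wall of $A$ (that is, $\overline A$ contains a point of it that is on no other hyperplane) and $l(B)=l(A)+1$; write $D<A$ if there is a directed path of positive length from $D$ to $A$. The group $\mathcal D$ acts on pairs of alcoves, and the orbit of an edge is meant in this sense. The parabolic Kazhdan–Lusztig polynomials $p_{A,D}=p_A(D)\in\mathbb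 Z[v]$ of $\mathcal D/\mathcal D_+$, for dominant alcoves $A,D$, are given by the following recursion. For the root, $p_{C'}(C')=1$ and $p_{C'}(D)=0$ if $D\ne C'$. For $A\neq C'$ pick an edge $(B,A)$ of $G$, and put $$p'_A(D)=\sum_{D'}\bigl(v^{-1}p_B(D)+p_B(D')\bigr)+\sum_{D''}\bigl(v\,p_B(D)+p_B(D'')\bigr),$$ where $D'$ runs over the dominant alcoves such that $(D',D)$ is an edge of $G$ in the orbit of $(B,A)$, and $D''$ over those such that $(D,D'')$ is an edge of $G$ in this orbit. Then $$p_A=p'_A-\sum_{D<A}p'_A(D)|_{v=0}\;p_D .$$ Label a dominant alcove $A$ by the set of positive entries of the point of the orbit $\mathcal D v_-$ that lies in $A$. For a finite set $a\subset\mathbb N$, regarded as the binary sequence with a $1$ in position $i$ if and only if $i\in a$, the set of arcs $\Gamma^a$ is obtained as follows: join every $0$ to a $1$ that follows it immediately; ignore the positions joined so far and repeat, until no $0$ is followed immediately by a $1$ in the remaining sequence; finally join the remaining $1$s in adjacent pairs from the left (leaving out the last one if their number is odd). The hypercube $h^a$ has one vertex for each subset $S\subseteq\Gamma^a$, namely the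 set obtained from $a$ by replacing $01\to10$ or $11\to00$ at the ends of each arc in $S$; this vertex is at depth $|S|$. Theorem. The labelling is a bijection from the dominant alcoves to the finite subsets of $\mathbb N$ of even order. The polynomials $p_{A,B}$ do not depend on the edges picked in the recursion. If $A$ and $B$ have the labels $a$ and $b$, then $p_{A,B}=v^i$ if $b$ is a vertex of $h^a$ at depth $i$, and $p_{A,B}=0$ if $b$ is not a vertex of $h^a$. -/

import Mathlib

/-!
Positive integers `ℕ+ = {1, 2, 3, …}` index the coordinates of `ℝ^ℕ`.
-/

namespace DKL

open scoped LaurentPolynomial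

noncomputable section

/-- The space `ℝ^ℕ`. -/
abbrev Space : Type := ℕ+ → ℝ

/-! ### The reflection group `𝒟` and its hyperplanes -/

/-- Index of a reflection of `𝒟`: a pair `i < j` together with a sign. The value `neg = false`
stands for `(i j)`, the value `neg = true` for `(i j)₋`. -/
structure Refl where
  i : ℕ+
  j : ℕ+
  lt : i < j
  neg : Bool

/-- A linear form whose kernel is the reflection hyperplane:
`x_i - x_j` for `(i j)` and `x_i + x_j` for `(i j)₋`. -/
def Refl.form (r : Refl) (x : Space) : ℝ :=
  if r.neg then x r.i + x r.j else x r.i - x r.j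

/-- The reflection as a linear map: `(i j)` exchanges the coordinates `x_i` and `x_j`, and `(i j)₋`
replaces `x_i` by `-x_j` and `x_j` by `-x_i`. -/
def Refl.map (r : Refl) : Space →ₗ[ℝ] Space where
  toFun x k :=
    if k = r.i then (if r.neg then -x r.j else x r.j)
    else if k = r.j then (if r.neg then -x r.i else x r.i)
    else x k
  map_add' x y := by
    funext k
    simp only [Pi.add_apply]
    split_ifs <;> ring
  map_smul' c x := by
    funext k
    simp only [Pi.smul_apply, smul_eq_mul, RingHom.id_apply]
    split_ifs <;> ring

theorem Refl.map_involutive (r : Refl) : Function.Involutive r.map := by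
  intro x
  funext k
  have h : r.j ≠ r.i := ne_of_gt r.lt
  by_cases h1 : k = r.i
  · subst h1
    cases hn : r.neg <;> simp [Refl.map, h, hn]
  · by_cases h2 : k = r.j
    · subst h2
      cases hn : r.neg <;> simp [Refl.map, h, hn]
    · simp [Refl.map, h1, h2]

/-- The reflection as an invertible linear map. -/
def Refl.equiv (r : Refl) : Space ≃ₗ[ℝ] Space :=
  LinearEquiv.ofInvolutive r.map r.map_involutive

/-- The group `𝒟`, generated by all `(i j)` and all `(i j)₋`. -/
def D : Subgroup (Space ≃ₗ[ℝ] Space) :=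
  Subgroup.closure (Set.range Refl.equiv)

/-- The point `v₋ = (-1, -2, -3, …)`. -/
def vMinus : Space := fun k => -((k : ℕ) : ℝ)

/-- The set of points that lie, for every reflection hyperplane in `R`, strictly on the same side
as `x`. -/
def cell (R : Set Refl) (x : Space) : Set Space :=
  {y | ∀ r ∈ R, 0 < r.form x * r.form y}

/-- The fundamental alcove `C'`: the chamber of `𝒟` that contains `v₋`. -/
def fundAlcove : Set Space := cell Set.univ vMinus

/-- The fundamental chamber `C₀` of the parabolic `𝒟₊ = ⟨(i j)⟩`: its hyperplanes are those of the
reflections `(i j)`, and `C₀` is the set of strictly descending sequences. -/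
def fundChamber : Set Space := cell {r | r.neg = false} vMinus

/-- Alcoves: the images `w C'` with `w ∈ 𝒟`. -/
def IsAlcove (A : Set Space) : Prop := ∃ w ∈ D, A = w '' fundAlcove

/-- The set `X⁺` of dominant alcoves, those that lie in `C₀`. -/
abbrev DomAlcove : Type := {A : Set Space // IsAlcove A ∧ A ⊆ fundChamber}

/-- The number of reflection hyperplanes that separate `A` from `C'`. -/
def length (A : Set Space) : ℕ :=
  Set.ncard {r : Refl | ∀ x ∈ A, ∀ y ∈ fundAlcove, r.form x * r.form y < 0}

/-- The reflection `t` is simple for `A`: its hyperplane makes a wall of `A`, that is, the closure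
of `A` contains a point of this hyperplane that lies on no other reflection hyperplane. -/
def IsWall (t : Refl) (A : Set Space) : Prop :=
  ∃ x ∈ closure A, t.form x = 0 ∧ ∀ r : Refl, r ≠ t → r.form x ≠ 0

/-- Edges `(A, B)` of the digraph `G_a` on dominant alcoves. -/
def Edge (A B : DomAlcove) : Prop :=
  (∃ t : Refl, IsWall t A.1 ∧ B.1 = t.equiv '' A.1) ∧ length B.1 = length A.1 + 1

/-- The strict order on `X⁺` defined by the acyclic digraph. -/
def Lt (A B : DomAlcove) : Prop := Relation.TransGen Edge A B

theorem Edge.length_lt {A B : DomAlcove} (h : Edge A B) : length A.1 < length B.1 := by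
  have := h.2
  omega

theorem Lt.length_lt {A B : DomAlcove} (h : Lt A B) : length A.1 < length B.1 := by
  induction h with
  | single h => exact h.length_lt
  | tail _ h ih => exact ih.trans h.length_lt

/-- The pair `(A', B')` lies in the `𝒟`-orbit of the pair `(A, B)`. -/
def SameOrbit (A B A' B' : DomAlcove) : Prop :=
  ∃ w ∈ D, A'.1 = w '' A.1 ∧ B'.1 = w '' B.1

/-! ### Parabolic Kazhdan–Lusztig polynomials of `𝒟/𝒟₊`

Polynomials in `v` are regarded as Laurent polynomials over `ℤ`, with `v = T 1`. -/

/-- The row `p'_A`, computed from the row `p = p_B` along an edge `(B, A)`. In the first sum `D'` is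
the lower end of an edge `(D', D)` in the orbit of `(B, A)`; in the second sum `D'` is the upper end
of an edge `(D, D')` in this orbit. -/
def preRow (B A : DomAlcove) (p : DomAlcove → ℤ[T;T⁻¹]) (E : DomAlcove) : ℤ[T;T⁻¹] :=
  (∑ᶠ E' ∈ {E' : DomAlcove | Edge E' E ∧ SameOrbit B A E' E},
      (LaurentPolynomial.T (-1) * p E + p E')) +
  (∑ᶠ E' ∈ {E' : DomAlcove | Edge E E' ∧ SameOrbit B A E E'},
      (LaurentPolynomial.T 1 * p E + p E'))

/-- A choice of one edge `(B, A)` for each `A` at which some edge ends. -/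
abbrev EdgeChoice : Type := ∀ A : DomAlcove, (∃ B, Edge B A) → {B : DomAlcove // Edge B A}

open Classical in
/-- The row `p_A` of the array of parabolic Kazhdan–Lusztig polynomials, computed recursively with
the edges chosen by `c`. At the root the row is `p_{A,A} = 1`, `p_{A,E} = 0` for `E ≠ A`. Otherwise
`p_A = p'_A - ∑_{F < A} p'_A(F)(v = 0) p_F`, where the value at `v = 0` is the constant
coefficient. -/
def pKL (c : EdgeChoice) (A : DomAlcove) : DomAlcove → ℤ[T;T⁻¹] :=
  if h : ∃ B, Edge B A then
    fun E =>
      preRow (c A h).1 A (pKL c (c A h).1) E -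
        ∑ᶠ F : {F : DomAlcove // Lt F A},
          LaurentPolynomial.C ((preRow (c A h).1 A (pKL c (c A h).1) F.1).coeff 0) *
            pKL c F.1 E
  else Pi.single A 1
termination_by length A.1
decreasing_by
  all_goals first
    | exact (c A h).2.length_lt
    | exact F.2.length_lt

/-- The label of a dominant alcove: the set of positive entries of the point of the orbit `𝒟 v₋`
inside the alcove. -/
def label (A : DomAlcove) : Set ℕ+ :=
  {n | ∃ w ∈ D, w vMinus ∈ A.1 ∧ ∃ k : ℕ+, w vMinus k = ((n : ℕ) : ℝ)}

/-! ### Temperley–Lieb arcs and hypercubes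

An arc with ends `i < j` is the pair `(i, j)`. A finite set `a` is identified with the binary
sequence that has a 1 in position `i` exactly if `i ∈ a`. -/

/-- The vertex `k` is an end of one of the arcs in `S`. -/
def Covered (S : Set (ℕ+ × ℕ+)) (k : ℕ+) : Prop := ∃ p ∈ S, k = p.1 ∨ k = p.2

/-- The 01-arcs drawn in the first `n` rounds: each round ignores the vertices that are already
paired and joins every 0 to a 1 that follows it immediately in the remaining sequence. -/
def arcs01 (a : Finset ℕ+) : ℕ → Set (ℕ+ × ℕ+)
  | 0 => ∅
  | n + 1 => arcs01 a n ∪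
      {p | p.1 < p.2 ∧ p.1 ∉ a ∧ p.2 ∈ a ∧
        ¬ Covered (arcs01 a n) p.1 ∧ ¬ Covered (arcs01 a n) p.2 ∧
        ∀ k, p.1 < k → k < p.2 → Covered (arcs01 a n) k}

/-- The positions of the 1s that remain when no 01-arc can be added. -/
def freeOnes (a : Finset ℕ+) : Set ℕ+ :=
  {k | k ∈ a ∧ ∀ n, ¬ Covered (arcs01 a n) k}

/-- The 11-arcs: the remaining 1s are joined in adjacent pairs from the left. -/
def arcs11 (a : Finset ℕ+) : Set (ℕ+ × ℕ+) :=
  {p | p.1 < p.2 ∧ p.1 ∈ freeOnes a ∧ p.2 ∈ freeOnes a ∧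
    (∀ k ∈ freeOnes a, ¬ (p.1 < k ∧ k < p.2)) ∧
    Even (Set.ncard {k ∈ freeOnes a | k < p.1})}

/-- The set `Γ^a` of all arcs of the TL-diagram of `a`. -/
def arcs (a : Finset ℕ+) : Set (ℕ+ × ℕ+) := (⋃ n, arcs01 a n) ∪ arcs11 a

/-- `b` is a vertex of the hypercube `h^a` at depth `d`: it is obtained from `a` by the
transformations 01 → 10 and 11 → 00 at the ends of each of `d` arcs of `Γ^a`. As the arcs have no
ends in common, this toggles all the ends of these arcs. -/
def AtDepth (a b : Finset ℕ+) (d : ℕ) : Prop :=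
  ∃ S : Finset (ℕ+ × ℕ+), (S : Set (ℕ+ × ℕ+)) ⊆ arcs a ∧ S.card = d ∧
    b = symmDiff a (S.biUnion fun p => {p.1, p.2})

end

end DKL

/-! ### The arcs of a diagram, read off from a lattice path. -/

namespace DKL

/-! ### Heights -/

/-! The correction sum in the recursion always vanishes: one step along an edge takes the hypercube
of the lower label exactly to that of the upper label, whose constant coefficient at every other
label is zero. By induction on length, every row is then a hypercube, whatever edges are picked.

The step is the Temperley–Lieb action on diagrams. An edge toggles two positions x and y: either k
and k+1, with 10 becoming 01, or 1 and 2, with 00 becoming 11. The upper diagram joins x to y and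
joins the former partners of x and y to each other, if both exist (`joined_shift`, `joined_create`).
To prove this, arcs are described by heights of a lattice path: a 01-arc is an excursion, and the
remaining 1s are the first passages to -1, -2, -3, …, paired as (odd, next even). A shift turns a
valley into a peak; a creation lowers the path by 4 from position 2 on.

Being at depth d in the hypercube of `a` means that the symmetric difference with `a` is a union of
d arcs. For the reconnected matching, a set avoiding x and y is such a union exactly if it, or it
together with x and y, is one for the old matching; the two cases exclude each other. This gives the
two formulas of the recursion (`weight_reconnect`, `weight_reconnect_insert`).

On the geometric side, elements of 𝒟 are permutations with an even number of sign changes. A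
dominant alcove is determined by the label, since its orbit point is descending
(`Signed.ext_of_strictAnti`). The length is the sum of m-1 over the label (`length_eq`), and edges
are right multiplications by simple reflections (`edge_iff`), which toggle two positions of the
label (`lab_of_rep_eq`). All of this meets in `preRow_hypercube`. -/

/-- The height of the lattice path of `a` after `n` steps; a 0 is a step up and a 1 a step down. -/
def ht (a : Finset ℕ+) : ℕ → ℤ
  | 0 => 0
  | n + 1 => ht a n + if n.succPNat ∈ a then -1 else 1

theorem ht_of_mem {a : Finset ℕ+} {k : ℕ+} (h : k ∈ a) : ht a k = ht a (k - 1) - 1 := by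
  obtain ⟨n, rfl⟩ : ∃ n : ℕ, k = n.succPNat := ⟨k.natPred, by simp⟩
  simp [ht, h]; ring

theorem ht_of_notMem {a : Finset ℕ+} {k : ℕ+} (h : k ∉ a) : ht a k = ht a (k - 1) + 1 := by
  obtain ⟨n, rfl⟩ : ∃ n : ℕ, k = n.succPNat := ⟨k.natPred, by simp⟩
  simp [ht, h]

theorem ht_succ (a : Finset ℕ+) (n : ℕ) :
    ht a (n + 1) = ht a n + 1 ∨ ht a (n + 1) = ht a n - 1 := by
  by_cases h : n.succPNat ∈ a
  · right; simp [ht, h]; ring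
  · left; simp [ht, h]

theorem mem_of_ht_lt {a : Finset ℕ+} {k : ℕ+} (h : ht a k < ht a (k - 1)) : k ∈ a := by
  by_contra hk
  have := ht_of_notMem hk
  omega

theorem notMem_of_lt_ht {a : Finset ℕ+} {k : ℕ+} (h : ht a (k - 1) < ht a k) : k ∉ a := by
  intro hk
  have := ht_of_mem hk
  omega

/-- The path returns to its height before step `i` at step `j`, and is higher in between. -/
def Arc01 (a : Finset ℕ+) (i j : ℕ+) : Prop :=
  i < j ∧ ht a j = ht a (i - 1) ∧ ∀ m : ℕ, i ≤ m → m < j → ht a (i - 1) < ht a m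

/-- The path reaches the height `-m` for the first time at step `j`. -/
def First (a : Finset ℕ+) (m : ℤ) (j : ℕ+) : Prop :=
  ht a j = -m ∧ ∀ n : ℕ, n < j → -m < ht a n

section
variable {a : Finset ℕ+} {i j k i' j' : ℕ+} {m m' : ℤ}

theorem Arc01.lt (h : Arc01 a i j) : (i : ℕ) < j := h.1

theorem Arc01.left (h : Arc01 a i j) : i ∉ a :=
  notMem_of_lt_ht (h.2.2 i le_rfl h.1)

theorem Arc01.right (h : Arc01 a i j) : j ∈ a := by
  have := h.lt
  have := h.2.2 (j - 1) (by omega) (by have := j.pos; omega)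
  exact mem_of_ht_lt (by rw [h.2.1]; exact this)

theorem First.mem (h : First a m j) : j ∈ a := by
  have := h.2 (j - 1) (by have := j.pos; omega)
  exact mem_of_ht_lt (by rw [h.1]; exact this)

theorem First.pos (h : First a m j) : 0 < m := by
  have := h.2 0 j.pos
  simp [ht] at this
  exact this

theorem Arc01.right_unique (h : Arc01 a i j) (h' : Arc01 a i j') : j = j' := by
  have h1 := h.lt
  have h2 := h'.lt
  rcases lt_trichotomy (j : ℕ) j' with hl | hl | hl
  · have := h'.2.2 j (by omega) hl
    have := h.2.1
    omega
  · exact PNat.coe_injective hl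
  · have := h.2.2 j' (by omega) hl
    have := h'.2.1
    omega

theorem Arc01.left_unique (h : Arc01 a i j) (h' : Arc01 a i' j) : i = i' := by
  have h1 := h.lt
  have h2 := h'.lt
  have e1 := h.2.1
  have e2 := h'.2.1
  rcases lt_trichotomy (i : ℕ) i' with hl | hl | hl
  · have := h.2.2 (i' - 1) (by omega) (by omega)
    omega
  · exact PNat.coe_injective hl
  · have := h'.2.2 (i - 1) (by omega) (by omega)
    omega

/-- A first passage is a strict new minimum, whereas the right end of an arc only returns to an
earlier height. -/
theorem First.not_arc (h : First a m j) : ¬ Arc01 a i j := by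
  intro h'
  have := h'.lt
  have := h.2 (i - 1) (by omega)
  have := h'.2.1
  have := h.1
  omega

theorem First.unique (h : First a m j) (h' : First a m j') : j = j' := by
  rcases lt_trichotomy (j : ℕ) j' with hl | hl | hl
  · have := h'.2 j hl
    have := h.1
    omega
  · exact PNat.coe_injective hl
  · have := h.2 j' hl
    have := h'.1
    omega

theorem First.height_unique (h : First a m j) (h' : First a m' j) : m = m' := by
  have := h.1
  have := h'.1
  omega

theorem First.lt_of_lt (h : First a m j) (h' : First a m' j') (hm : m < m') : j < j' := by
  by_contra hl
  rw [not_lt] at hl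
  rcases eq_or_lt_of_le hl with rfl | hl
  · exact hm.ne (h.height_unique h')
  · have := h.2 j' hl
    have := h'.1
    omega

/-- A 0 is joined to a later 1 if the path returns to its height before this 0. -/
theorem exists_arc_right (hk : k ∉ a) {n : ℕ} (hn : (k : ℕ) < n) (hh : ht a n ≤ ht a (k - 1)) :
    ∃ d : ℕ+, Arc01 a k d ∧ (d : ℕ) ≤ n := by
  classical
  have hex : ∃ n : ℕ, (k : ℕ) < n ∧ ht a n ≤ ht a (k - 1) := ⟨n, hn, hh⟩
  obtain ⟨h1, h2⟩ := Nat.find_spec hex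
  have hmin := fun m => Nat.find_min (H := hex) (m := m)
  have hle : Nat.find hex ≤ n := Nat.find_le ⟨hn, hh⟩
  set d := Nat.find hex
  have h0 := ht_of_notMem hk
  have key : ∀ m : ℕ, (k : ℕ) ≤ m → m < d → ht a (k - 1) < ht a m := by
    intro m hm hmd
    rcases eq_or_lt_of_le hm with rfl | hm
    · omega
    · have := hmin m hmd
      by_contra hc
      exact this ⟨hm, by omega⟩
  have hd := key (d - 1) (by omega) (by omega)
  have hs := ht_succ a (d - 1)
  rw [show d - 1 + 1 = d by omega] at hs
  refine ⟨⟨d, by omega⟩, ⟨h1, ?_, key⟩, hle⟩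
  simp only [PNat.mk_coe]
  omega

/-- A 1 is joined to an earlier 0 if the path has been as low as after this 1. -/
theorem exists_arc_left (hj : j ∈ a) {n : ℕ} (hn : n < j) (hh : ht a n ≤ ht a j) :
    ∃ c : ℕ+, Arc01 a c j ∧ n < (c : ℕ) := by
  classical
  -- The search runs backwards from `j - 1`, so that the least `d` gives the latest low point before
  -- `j`.
  have hex : ∃ d : ℕ, d < j ∧ ht a (j - 1 - d) ≤ ht a j :=
    ⟨j - 1 - n, by omega, by rwa [show (j : ℕ) - 1 - (j - 1 - n) = n by omega]⟩
  obtain ⟨h1, h2⟩ := Nat.find_spec hex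
  have hmin := fun m => Nat.find_min (H := hex) (m := m)
  have hle : Nat.find hex ≤ j - 1 - n :=
    Nat.find_le ⟨by omega, by rwa [show (j : ℕ) - 1 - (j - 1 - n) = n by omega]⟩
  set d := Nat.find hex
  have h0 := ht_of_mem hj
  have hd0 : d ≠ 0 := by
    intro h
    rw [h] at h2
    simp at h2
    omega
  have key : ∀ m : ℕ, (j : ℕ) - 1 - d < m → m < j → ht a j < ht a m := by
    intro m hm hmd
    by_contra hc
    refine hmin (j - 1 - m) (by omega) ⟨by omega, ?_⟩
    rw [show (j : ℕ) - 1 - (j - 1 - m) = m by omega]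
    omega
  have hk := key (j - 1 - d + 1) (by omega) (by omega)
  have hs := ht_succ a (j - 1 - d)
  have he : ht a (j - 1 - d) = ht a j := by omega
  refine ⟨⟨j - 1 - d + 1, by omega⟩, ⟨?_, ?_, ?_⟩, ?_⟩
  · change (j : ℕ) - 1 - d + 1 < j
    omega
  · simp only [PNat.mk_coe, Nat.add_sub_cancel]
    exact he.symm
  · intro m hm hmj
    simp only [PNat.mk_coe, Nat.add_sub_cancel] at hm ⊢
    rw [he]
    exact key m (by omega) hmj
  · simp only [PNat.mk_coe]
    omega

theorem exists_first (hm : 0 < m) {n : ℕ} (hn : ht a n ≤ -m) :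
    ∃ j : ℕ+, First a m j ∧ (j : ℕ) ≤ n := by
  classical
  have hex : ∃ n : ℕ, ht a n ≤ -m := ⟨n, hn⟩
  have h2 := Nat.find_spec hex
  have hmin := fun m => Nat.find_min (H := hex) (m := m)
  have hle : Nat.find hex ≤ n := Nat.find_le hn
  set d := Nat.find hex
  have hd0 : d ≠ 0 := by
    intro h
    rw [h] at h2
    simp [ht] at h2
    omega
  have hs := ht_succ a (d - 1)
  rw [show d - 1 + 1 = d by omega] at hs
  have := hmin (d - 1) (by omega)
  refine ⟨⟨d, by omega⟩, ⟨?_, ?_⟩, hle⟩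
  · simp only [PNat.mk_coe]
    omega
  · intro n hn
    have := hmin n hn
    omega

end

/-! ### Rounds of 01-arcs -/

theorem arcs01_mono (a : Finset ℕ+) : Monotone (arcs01 a) :=
  monotone_nat_of_le_succ fun _ _ h => Or.inl h

theorem Covered.mono {S T : Set (ℕ+ × ℕ+)} (h : S ⊆ T) {k : ℕ+} : Covered S k → Covered T k :=
  fun ⟨p, hp, hk⟩ => ⟨p, h hp, hk⟩

theorem arcs01_between {a : Finset ℕ+} {n : ℕ} {p : ℕ+ × ℕ+} (hp : p ∈ arcs01 a n) {k : ℕ+}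
    (h1 : p.1 < k) (h2 : k < p.2) : Covered (arcs01 a n) k := by
  induction n with
  | zero => exact hp.elim
  | succ n ih =>
    rcases hp with hp | hp
    · exact (ih hp).mono fun _ h => Or.inl h
    · exact (hp.2.2.2.2.2 k h1 h2).mono fun _ h => Or.inl h

/-- The vertices under a new arc are ends of earlier arcs, which must lie under it too. By induction
on rounds these are excursions, so the stretch between the ends is balanced and never dips. -/
theorem Arc01.of_mem_arcs01 {a : Finset ℕ+} {n : ℕ} {p : ℕ+ × ℕ+} (hp : p ∈ arcs01 a n) :
    Arc01 a p.1 p.2 := by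
  induction n generalizing p with
  | zero => exact hp.elim
  | succ n ih =>
    rcases hp with hp | ⟨hlt, hl, hr, hcl, hcr, hb⟩
    · exact ih hp
    obtain ⟨i, j⟩ := p
    dsimp only at *
    have hlt' : (i : ℕ) < j := hlt
    -- the arcs that cover the vertices in between lie in between
    have hin : ∀ k : ℕ+, i < k → k < j → ∃ q : ℕ+ × ℕ+, i < q.1 ∧ q.2 < j ∧ Arc01 a q.1 q.2 ∧
        (k = q.1 ∨ k = q.2) := by
      intro k h1 h2
      obtain ⟨q, hq, hk⟩ := hb k h1 h2
      have hq' := ih hq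
      refine ⟨q, ?_, ?_, hq', hk⟩
      · by_contra hc
        rcases hk with rfl | rfl
        · exact hc h1
        · rcases eq_or_lt_of_le (not_lt.1 hc) with he | he
          · exact hcl ⟨q, hq, Or.inl he.symm⟩
          · exact hcl (arcs01_between hq he h1)
      · by_contra hc
        rcases hk with rfl | rfl
        · rcases eq_or_lt_of_le (not_lt.1 hc) with he | he
          · exact hcr ⟨q, hq, Or.inr he⟩
          · exact hcr (arcs01_between hq h2 he)
        · exact hc h2
    have hi := ht_of_notMem hl
    have hj := ht_of_mem hr
    -- Left ends of inner arcs are steps up; at a right end the path is back at the height before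
    -- the matching left end, which the induction has treated.
    have up : ∀ m : ℕ, (i : ℕ) ≤ m → m < j → ht a (i - 1) < ht a m := by
      intro m
      induction m using Nat.strong_induction_on with
      | _ m IH =>
        intro h1 h2
        rcases eq_or_lt_of_le h1 with rfl | h1
        · omega
        obtain ⟨q, hq1, hq2, hq, hk⟩ := hin ⟨m, by omega⟩ h1 h2
        have hq1' : (i : ℕ) < q.1 := hq1
        rcases hk with hk | hk
        · have hm : m = (q.1 : ℕ) := congrArg PNat.val hk
          have := IH (m - 1) (by omega) (by omega) (by omega)
          have := ht_of_notMem hq.left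
          rw [← hm] at this
          omega
        · have hm : m = (q.2 : ℕ) := congrArg PNat.val hk
          have h3 := hq.lt
          have := IH (q.1 - 1) (by omega) (by omega) (by omega)
          have := hq.2.1
          rw [← hm] at this
          omega
    -- The mirror image, walking backwards from `j - 1`. At `i` it bounds `ht a (j - 1)` from above,
    -- and `up` bounds it from below, which fixes the height at `j`.
    have down : ∀ d : ℕ, d < (j : ℕ) - i → ht a (j - 1) ≤ ht a (j - 1 - d) := by
      intro d
      induction d using Nat.strong_induction_on with
      | _ d IH =>
        intro h1
        rcases Nat.eq_zero_or_pos d with rfl | h0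
        · simp
        obtain ⟨q, hq1, hq2, hq, hk⟩ := hin ⟨j - d, by omega⟩
          (by change (i : ℕ) < j - d; omega) (by change (j : ℕ) - d < j; omega)
        have hq2' : (q.2 : ℕ) < j := hq2
        rcases hk with hk | hk
        · have hm : (j : ℕ) - d = (q.1 : ℕ) := congrArg PNat.val hk
          have h3 := hq.lt
          have := IH (j - 1 - q.2) (by omega) (by omega)
          rw [show (j : ℕ) - 1 - (j - 1 - q.2) = q.2 by omega] at this
          rw [show (j : ℕ) - 1 - d = q.1 - 1 by omega, ← hq.2.1]
          exact this
        · have hm : (j : ℕ) - d = (q.2 : ℕ) := congrArg PNat.val hk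
          have := IH (d - 1) (by omega) (by omega)
          rw [show (j : ℕ) - 1 - (d - 1) = q.2 by omega] at this
          rw [show (j : ℕ) - 1 - d = q.2 - 1 by omega]
          have := ht_of_mem hq.right
          omega
    refine ⟨hlt, ?_, up⟩
    have h1 := down (j - 1 - i) (by omega)
    rw [show (j : ℕ) - 1 - (j - 1 - i) = i by omega] at h1
    have h2 := up (j - 1) (by omega) (by omega)
    omega

/-- Strong induction on the span: each vertex under an excursion is an end of a shorter excursion
inside it, hence covered after finitely many rounds, and the next round can join the two ends. -/
theorem Arc01.exists_mem_arcs01 {a : Finset ℕ+} {i j : ℕ+} (h : Arc01 a i j) :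
    ∃ n, (i, j) ∈ arcs01 a n := by
  obtain ⟨d, hd⟩ : ∃ d, d = (j : ℕ) - i := ⟨_, rfl⟩
  induction d using Nat.strong_induction_on generalizing i j with
  | _ d IH =>
    have hij := h.lt
    -- The bounds on `k` stand inside the existential so that `choose` yields a total function.
    have hin : ∀ k : ℕ+, ∃ n, i < k → k < j → Covered (arcs01 a n) k := by
      intro k
      by_cases hk : i < k ∧ k < j
      · obtain ⟨h1, h2⟩ := hk
        have h1' : (i : ℕ) < k := h1
        have h2' : (k : ℕ) < j := h2
        by_cases hk : k ∈ a
        · have := h.2.2 k h1'.le h2'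
          obtain ⟨c, hc, hic⟩ := exists_arc_left hk (n := i - 1) (by omega) (by omega)
          have hne : (c : ℕ) ≠ i := by
            intro he
            have := PNat.coe_injective he
            subst this
            have := hc.2.1
            omega
          have := hc.lt
          obtain ⟨n, hn⟩ := IH (k - c) (by omega) hc rfl
          exact ⟨n, fun _ _ => ⟨_, hn, Or.inr rfl⟩⟩
        · have := h.2.2 (k - 1) (by omega) (by omega)
          have := h.2.1
          obtain ⟨c, hc, hic⟩ := exists_arc_right hk (n := j) h2' (by omega)
          have hkc := hc.lt
          obtain ⟨n, hn⟩ := IH (c - k) (by omega) hc rfl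
          exact ⟨n, fun _ _ => ⟨_, hn, Or.inl rfl⟩⟩
      · exact ⟨0, fun h1 h2 => (hk ⟨h1, h2⟩).elim⟩
    choose f hf using hin
    set N := (Finset.Icc i j).sup f with hN
    -- If an end is already taken, uniqueness of partners shows that the arc taking it is `(i, j)`
    -- itself.
    by_cases hc : Covered (arcs01 a N) i ∨ Covered (arcs01 a N) j
    · refine ⟨N, ?_⟩
      have conv : ∀ q ∈ arcs01 a N, (i = q.1 ∨ i = q.2 ∨ j = q.1 ∨ j = q.2) →
          (i, j) ∈ arcs01 a N := by
        rintro ⟨c, d⟩ hq hk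
        have hq' := Arc01.of_mem_arcs01 hq
        dsimp only at hq' hk
        rcases hk with rfl | rfl | rfl | rfl
        · rwa [h.right_unique hq']
        · exact (h.left hq'.right).elim
        · exact (hq'.left h.right).elim
        · rwa [h.left_unique hq']
      rcases hc with ⟨q, hq, hk⟩ | ⟨q, hq, hk⟩
      · exact conv q hq (by tauto)
      · exact conv q hq (by tauto)
    · rw [not_or] at hc
      refine ⟨N + 1, Or.inr ⟨h.1, h.left, h.right, hc.1, hc.2, fun k h1 h2 => ?_⟩⟩
      exact (hf k h1 h2).mono
        (arcs01_mono a (Finset.le_sup (f := f) (Finset.mem_Icc.2 ⟨h1.le, h2.le⟩)))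

theorem mem_iUnion_arcs01 {a : Finset ℕ+} {i j : ℕ+} : (i, j) ∈ ⋃ n, arcs01 a n ↔ Arc01 a i j := by
  rw [Set.mem_iUnion]
  exact ⟨fun ⟨_, h⟩ => Arc01.of_mem_arcs01 h, fun h => h.exists_mem_arcs01⟩

/-! ### The remaining 1s -/

/-- A 1 stays free exactly if the path was never as low before; an earlier point as low would supply
a partner. -/
theorem mem_freeOnes {a : Finset ℕ+} {k : ℕ+} : k ∈ freeOnes a ↔ ∃ m, First a m k := by
  constructor
  · rintro ⟨hk, hc⟩
    refine ⟨-ht a k, by simp, fun n hn => ?_⟩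
    by_contra hle
    obtain ⟨c, hck, -⟩ := exists_arc_left hk hn (by omega)
    obtain ⟨N, hN⟩ := hck.exists_mem_arcs01
    exact hc N ⟨_, hN, Or.inr rfl⟩
  · rintro ⟨m, hm⟩
    refine ⟨hm.mem, fun n ⟨q, hq, hk⟩ => ?_⟩
    have hq' := Arc01.of_mem_arcs01 hq
    rcases hk with rfl | rfl
    · exact hq'.left hm.mem
    · exact hm.not_arc hq'

/-- The free 1s before `k` are the first passages to -1, …, -m, so the height counts them. This
turns pairing from the left into a parity condition on depth. -/
theorem ncard_freeOnes_lt {a : Finset ℕ+} {m : ℕ} {k : ℕ+} (h : First a (m + 1 : ℕ) k) :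
    Set.ncard {l ∈ freeOnes a | l < k} = m := by
  rw [← Nat.card_Icc 1 m |>.trans (by omega : m + 1 - 1 = m), ← Set.ncard_coe_finset]
  refine Set.ncard_congr (fun l _ => (-ht a l).toNat) ?_ ?_ ?_
  · rintro l ⟨hl, hlk⟩
    obtain ⟨m', hm'⟩ := mem_freeOnes.1 hl
    have h1 := hm'.pos
    have h2 := hm'.1
    have h3 := h.2 l hlk
    simp only [Finset.coe_Icc, Set.mem_Icc]
    push_cast at h3
    omega
  · rintro l l' ⟨hl, hlk⟩ ⟨hl', hlk'⟩ he
    obtain ⟨n, hn⟩ := mem_freeOnes.1 hl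
    obtain ⟨n', hn'⟩ := mem_freeOnes.1 hl'
    have h1 := hn.pos
    have h2 := hn.1
    have h1' := hn'.pos
    have h2' := hn'.1
    have : n = n' := by omega
    subst this
    exact hn.unique hn'
  · intro b hb
    simp only [Finset.coe_Icc, Set.mem_Icc] at hb
    have hk := h.1
    push_cast at hk
    obtain ⟨j, hj, hjk⟩ := exists_first (a := a) (m := b) (by omega) (n := k) (by omega)
    refine ⟨j, ⟨mem_freeOnes.2 ⟨_, hj⟩, hj.lt_of_lt h (by push_cast; omega)⟩, ?_⟩
    rw [hj.1]
    simp

/-- The arcs of the diagram of `a` in terms of heights. -/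
def IsArc (a : Finset ℕ+) (i j : ℕ+) : Prop :=
  Arc01 a i j ∨ ∃ t : ℕ, First a (2 * t + 1) i ∧ First a (2 * t + 2) j

theorem mem_arcs11 {a : Finset ℕ+} {i j : ℕ+} :
    (i, j) ∈ arcs11 a ↔ ∃ t : ℕ, First a (2 * t + 1) i ∧ First a (2 * t + 2) j := by
  constructor
  · rintro ⟨hij, hi, hj, hb, he⟩
    dsimp only at *
    obtain ⟨m, hm⟩ := mem_freeOnes.1 hi
    obtain ⟨n, hn⟩ := mem_freeOnes.1 hj
    have hm0 := hm.pos
    obtain ⟨m, rfl⟩ : ∃ s : ℕ, m = (s + 1 : ℕ) := ⟨(m - 1).toNat, by omega⟩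
    rw [ncard_freeOnes_lt hm] at he
    obtain ⟨t, rfl⟩ := he
    have hlt : ((t + t + 1 : ℕ) : ℤ) < n := by
      have := hn.2 i hij
      have := hm.1
      omega
    -- Otherwise the first passage to `-(2 * t + 2)` would be a free 1 strictly between the two
    -- ends.
    have hnt : n = 2 * t + 2 := by
      by_contra hne
      have := hn.1
      obtain ⟨k, hk, -⟩ := exists_first (a := a) (m := 2 * t + 2) (by omega) (n := j)
        (by push_cast at hlt; omega)
      refine hb k (mem_freeOnes.2 ⟨_, hk⟩) ⟨hm.lt_of_lt hk ?_, hk.lt_of_lt hn ?_⟩ <;>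
        (push_cast at *; omega)
    refine ⟨t, ?_, hnt ▸ hn⟩
    convert hm using 1
    push_cast
    ring
  · rintro ⟨t, hi, hj⟩
    refine ⟨hi.lt_of_lt hj (by omega), mem_freeOnes.2 ⟨_, hi⟩, mem_freeOnes.2 ⟨_, hj⟩, ?_, ?_⟩
    · rintro k hk ⟨h1, h2⟩
      dsimp only at *
      obtain ⟨m, hm⟩ := mem_freeOnes.1 hk
      have := hj.2 k h2
      have := hm.2 i h1
      have := hm.1
      have := hi.1
      omega
    · have : First a ((2 * t + 1 : ℕ) : ℤ) i := by exact_mod_cast hi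
      dsimp only
      rw [ncard_freeOnes_lt this]
      exact even_two_mul t

theorem mem_arcs {a : Finset ℕ+} {i j : ℕ+} : (i, j) ∈ arcs a ↔ IsArc a i j := by
  rw [arcs, Set.mem_union, mem_iUnion_arcs01, mem_arcs11, IsArc]

end DKL

/-! ### How the diagram changes along an edge. -/

namespace DKL

/-! ### The matching of the ends of arcs -/

/-- The vertices `i` and `j` are the ends of an arc of the diagram of `a`. -/
def Joined (a : Finset ℕ+) (i j : ℕ+) : Prop := IsArc a i j ∨ IsArc a j i

section
variable {a : Finset ℕ+} {i j j' : ℕ+}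

theorem Joined.symm (h : Joined a i j) : Joined a j i := Or.symm h

theorem IsArc.lt (h : IsArc a i j) : i < j := by
  rcases h with h | ⟨t, h1, h2⟩
  · exact h.1
  · exact h1.lt_of_lt h2 (by omega)

theorem IsArc.right_mem (h : IsArc a i j) : j ∈ a := by
  rcases h with h | ⟨t, h1, h2⟩
  · exact h.right
  · exact h2.mem

theorem Joined.ne (h : Joined a i j) : i ≠ j := by
  rcases h with h | h
  · exact h.lt.ne
  · exact h.lt.ne'

theorem Joined.mem_or_mem (h : Joined a i j) : i ∈ a ∨ j ∈ a := by
  rcases h with h | h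
  · exact Or.inr h.right_mem
  · exact Or.inl h.right_mem

theorem Joined.arc01_of_notMem (h : Joined a i j) (hi : i ∉ a) : Arc01 a i j := by
  rcases h with (h | ⟨t, h1, h2⟩) | h
  · exact h
  · exact (hi h1.mem).elim
  · exact (hi h.right_mem).elim

theorem Joined.cases_of_mem (h : Joined a i j) (hi : i ∈ a) : Arc01 a j i ∨
    (∃ t : ℕ, First a (2 * t + 1) i ∧ First a (2 * t + 2) j) ∨
    ∃ t : ℕ, First a (2 * t + 1) j ∧ First a (2 * t + 2) i := by
  rcases h with (h | h) | (h | h)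
  · exact (h.left hi).elim
  · exact Or.inr (Or.inl h)
  · exact Or.inl h
  · exact Or.inr (Or.inr h)

/-- First passages are not ends of 01-arcs, and the parity of the depth tells left ends of 11-arcs
from right ends. -/
theorem Joined.unique (h : Joined a i j) (h' : Joined a i j') : j = j' := by
  by_cases hi : i ∈ a
  · rcases h.cases_of_mem hi with h | ⟨t, h1, h2⟩ | ⟨t, h1, h2⟩ <;>
    rcases h'.cases_of_mem hi with h' | ⟨t', h1', h2'⟩ | ⟨t', h1', h2'⟩
    · exact h.left_unique h'
    · exact (h1'.not_arc h).elim
    · exact (h2'.not_arc h).elim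
    · exact (h1.not_arc h').elim
    · have := h1.height_unique h1'
      obtain rfl : t = t' := by omega
      exact h2.unique h2'
    · have := h1.height_unique h2'
      omega
    · exact (h2.not_arc h').elim
    · have := h2.height_unique h1'
      omega
    · have := h2.height_unique h2'
      obtain rfl : t = t' := by omega
      exact h1.unique h1'
  · exact (h.arc01_of_notMem hi).right_unique (h'.arc01_of_notMem hi)

end

/-- The matching obtained from `M` by joining `x` to `y`, and the partner of `x` to that of `y`. -/
def Reconnect (M : ℕ+ → ℕ+ → Prop) (x y i j : ℕ+) : Prop :=
  (i = x ∧ j = y) ∨ (i = y ∧ j = x) ∨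
    (i ≠ x ∧ i ≠ y ∧ j ≠ x ∧ j ≠ y ∧ (M i j ∨ (M i x ∧ M y j) ∨ (M i y ∧ M x j)))

/-- Once `x` and `y` are known to be joined, uniqueness of partners settles all pairs that involve
them. -/
theorem joined_iff_reconnect {a b : Finset ℕ+} {x y : ℕ+} (hxy : Joined a x y)
    (h : ∀ i j, i ≠ x → i ≠ y → j ≠ x → j ≠ y →
      (Joined a i j ↔ Joined b i j ∨ (Joined b i x ∧ Joined b y j) ∨ (Joined b i y ∧ Joined b x j)))
    (i j : ℕ+) : Joined a i j ↔ Reconnect (Joined b) x y i j := by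
  have hne := hxy.ne
  by_cases h1 : i = x
  · subst h1
    constructor
    · intro hj
      exact Or.inl ⟨rfl, hj.unique hxy⟩
    · rintro (⟨-, rfl⟩ | ⟨h, -⟩ | ⟨h, -⟩)
      · exact hxy
      · exact (hne h).elim
      · exact (h rfl).elim
  by_cases h2 : i = y
  · subst h2
    constructor
    · intro hj
      exact Or.inr (Or.inl ⟨rfl, hj.unique hxy.symm⟩)
    · rintro (⟨h, -⟩ | ⟨-, rfl⟩ | ⟨-, h, -⟩)
      · exact (h1 h).elim
      · exact hxy.symm
      · exact (h rfl).elim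
  by_cases h3 : j = x
  · subst h3
    refine iff_of_false (fun hj => h2 (hj.symm.unique hxy)) ?_
    rintro (⟨h, -⟩ | ⟨h, -⟩ | ⟨-, -, h, -⟩)
    exacts [h1 h, h2 h, h rfl]
  by_cases h4 : j = y
  · subst h4
    refine iff_of_false (fun hj => h1 (hj.symm.unique hxy.symm)) ?_
    rintro (⟨h, -⟩ | ⟨h, -⟩ | ⟨-, -, -, h, -⟩)
    exacts [h1 h, h2 h, h rfl]
  rw [h i j h1 h2 h3 h4, Reconnect]
  tauto

/-! ### Diagrams along the edges that move a 1 to the right -/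

section Shift
variable {a b : Finset ℕ+} {k : ℕ+}

/-- A valley at `k` becomes a peak; no other height changes. -/
theorem ht_shift (hk : k ∈ b) (hk1 : k + 1 ∉ b) (ha : a = symmDiff b {k, k + 1}) (n : ℕ) :
    ht a n = ht b n + if n = k then 2 else 0 := by
  have hne : k ≠ k + 1 := (PNat.lt_add_right k 1).ne
  have hka : k ∉ a := by simp [ha, Finset.mem_symmDiff, hk]
  have hka1 : k + 1 ∈ a := by simp [ha, Finset.mem_symmDiff, hk1]
  induction n with
  | zero =>
    rw [if_neg k.pos.ne]
    rfl
  | succ n ih =>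
    by_cases h1 : n + 1 = k
    · have : n.succPNat = k := PNat.coe_injective h1
      rw [if_neg (by omega)] at ih
      simp only [ht, this, hk, hka, ih, h1]
      simp
      ring
    by_cases h2 : n = k
    · have : n.succPNat = k + 1 := PNat.coe_injective (by simp [h2])
      rw [if_pos h2] at ih
      simp only [ht, this, hk1, hka1, ih, h1]
      simp
      ring
    · have e1 : n.succPNat ≠ k := fun h => h1 (by rw [← h]; rfl)
      have e2 : n.succPNat ≠ k + 1 := fun h => h2 (by
        have := congrArg PNat.val h
        simpa using this)
      have : n.succPNat ∈ a ↔ n.succPNat ∈ b := by simp [ha, Finset.mem_symmDiff, e1, e2]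
      rw [if_neg h2] at ih
      simp only [ht, this, ih, if_neg h1]
      ring

theorem ht_shift_of_ne (hk : k ∈ b) (hk1 : k + 1 ∉ b) (ha : a = symmDiff b {k, k + 1})
    {n : ℕ} (hn : n ≠ k) : ht a n = ht b n := by
  rw [ht_shift hk hk1 ha, if_neg hn, add_zero]

theorem ht_shift_self (hk : k ∈ b) (hk1 : k + 1 ∉ b) (ha : a = symmDiff b {k, k + 1}) :
    ht a k = ht b (k - 1) + 1 ∧ ht b k = ht b (k - 1) - 1 ∧
    ht b (k + 1) = ht b (k - 1) := by
  have h1 := ht_of_mem hk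
  have h2 := ht_of_notMem hk1
  have h3 := ht_shift hk hk1 ha k
  rw [PNat.add_coe, PNat.one_coe, Nat.add_sub_cancel] at h2
  rw [if_pos rfl] at h3
  omega

theorem arc01_shift_self (hk : k ∈ b) (hk1 : k + 1 ∉ b) (ha : a = symmDiff b {k, k + 1}) :
    Arc01 a k (k + 1) := by
  obtain ⟨h1, h2, h3⟩ := ht_shift_self hk hk1 ha
  have := k.pos
  have e1 := ht_shift_of_ne hk hk1 ha (n := k - 1) (by omega)
  have e2 := ht_shift_of_ne hk hk1 ha (n := k + 1) (by omega)
  refine ⟨PNat.lt_add_right k 1, ?_, ?_⟩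
  · rw [PNat.add_coe, PNat.one_coe, e2, e1, h3]
  · intro m hm hm'
    rw [PNat.add_coe, PNat.one_coe] at hm'
    obtain rfl : m = k := by omega
    omega

/-- Lowering the peak of `a` at `k` leaves an excursion intact, unless the valley then touches its
base line; in that case it splits at `k` into two. -/
theorem arc01_shift (hk : k ∈ b) (hk1 : k + 1 ∉ b) (ha : a = symmDiff b {k, k + 1})
    {i j : ℕ+} (hi : i ≠ k) (hi' : i ≠ k + 1) (hj : j ≠ k) (hj' : j ≠ k + 1) :
    Arc01 a i j ↔ Arc01 b i j ∨ (Arc01 b i k ∧ Arc01 b (k + 1) j) := by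
  obtain ⟨h1, h2, h3⟩ := ht_shift_self hk hk1 ha
  have hkp := k.pos
  have e := fun n => ht_shift_of_ne hk hk1 ha (n := n)
  have hi : (i : ℕ) ≠ k := fun h => hi (PNat.coe_injective h)
  have hj : (j : ℕ) ≠ k := fun h => hj (PNat.coe_injective h)
  have hi' : (i : ℕ) ≠ k + 1 := fun h => hi' (PNat.coe_injective (by simpa using h))
  have hj' : (j : ℕ) ≠ k + 1 := fun h => hj' (PNat.coe_injective (by simpa using h))
  have e1 := e (i - 1) (by omega)
  have e2 := e j hj
  have e3 := e (k - 1) (by omega)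
  have e4 := e (k + 1) (by omega)
  constructor
  · rintro ⟨hij, g1, g2⟩
    have hij' : (i : ℕ) < j := hij
    by_cases hc : (i : ℕ) < k ∧ (k : ℕ) < j ∧ ht b k = ht b (i - 1)
    · obtain ⟨c1, c2, c3⟩ := hc
      refine Or.inr ⟨⟨c1, c3, fun m hm hm' => ?_⟩, ⟨?_, ?_, fun m hm hm' => ?_⟩⟩
      · have := g2 m hm (by omega)
        rw [e m (by omega), e1] at this
        exact this
      · change ((k + 1 : ℕ+) : ℕ) < j
        rw [PNat.add_coe, PNat.one_coe]
        omega
      · rw [PNat.add_coe, PNat.one_coe, Nat.add_sub_cancel]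
        omega
      · rw [PNat.add_coe, PNat.one_coe] at *
        rw [Nat.add_sub_cancel]
        have := g2 m (by omega) (by omega)
        rw [e m (by omega)] at this
        omega
    · refine Or.inl ⟨hij, by omega, fun m hm hm' => ?_⟩
      have g := g2 m hm hm'
      by_cases hmk : m = k
      · subst hmk
        have := g2 (k - 1) (by omega) (by omega)
        have : ht b k ≠ ht b (i - 1) := fun h => hc ⟨by omega, by omega, h⟩
        omega
      · rw [e m hmk] at g
        omega
  · rintro (⟨hij, g1, g2⟩ | ⟨⟨hij, g1, g2⟩, ⟨hij', g1', g2'⟩⟩)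
    · refine ⟨hij, by omega, fun m hm hm' => ?_⟩
      have g := g2 m hm hm'
      by_cases hmk : m = k
      · subst hmk
        omega
      · rw [e m hmk]
        omega
    · have d1 : (i : ℕ) < k := hij
      have d2 : ((k + 1 : ℕ+) : ℕ) < j := hij'
      rw [PNat.add_coe, PNat.one_coe] at *
      rw [Nat.add_sub_cancel] at *
      refine ⟨?_, by omega, fun m hm hm' => ?_⟩
      · change (i : ℕ) < j
        omega
      · rcases lt_trichotomy m k with c | c | c
        · have := g2 m hm c
          rw [e m (by omega)]
          omega
        · subst c
          omega
        · have := g2' m (by omega) hm'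
          rw [e m (by omega)]
          omega

/-- If the valley of `b` was the first passage, the path of `a` reaches that level only at the
partner of `k + 1`. -/
theorem first_shift (hk : k ∈ b) (hk1 : k + 1 ∉ b) (ha : a = symmDiff b {k, k + 1})
    {m : ℤ} {j : ℕ+} (hj : j ≠ k) (hj' : j ≠ k + 1) :
    First a m j ↔ First b m j ∨ (First b m k ∧ Arc01 b (k + 1) j) := by
  obtain ⟨h1, h2, h3⟩ := ht_shift_self hk hk1 ha
  have hkp := k.pos
  have e := fun n => ht_shift_of_ne hk hk1 ha (n := n)
  have hj : (j : ℕ) ≠ k := fun h => hj (PNat.coe_injective h)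
  have hj' : (j : ℕ) ≠ k + 1 := fun h => hj' (PNat.coe_injective (by simpa using h))
  have e2 := e j hj
  have e3 := e (k - 1) (by omega)
  constructor
  · rintro ⟨g1, g2⟩
    by_cases hc : (k : ℕ) < j ∧ ht b k = -m
    · obtain ⟨c2, c3⟩ := hc
      refine Or.inr ⟨⟨c3, fun n hn => ?_⟩, ⟨?_, ?_, fun m hm hm' => ?_⟩⟩
      · have := g2 n (by omega)
        rw [e n (by omega)] at this
        exact this
      · change ((k + 1 : ℕ+) : ℕ) < j
        rw [PNat.add_coe, PNat.one_coe]
        omega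
      · rw [PNat.add_coe, PNat.one_coe, Nat.add_sub_cancel]
        omega
      · rw [PNat.add_coe, PNat.one_coe] at *
        rw [Nat.add_sub_cancel]
        have := g2 m (by omega)
        rw [e m (by omega)] at this
        omega
    · refine Or.inl ⟨by omega, fun n hn => ?_⟩
      have g := g2 n hn
      by_cases hmk : n = k
      · subst hmk
        have := g2 (k - 1) (by omega)
        have : ht b k ≠ -m := fun h => hc ⟨hn, h⟩
        omega
      · rw [e n hmk] at g
        omega
  · rintro (⟨g1, g2⟩ | ⟨⟨g1, g2⟩, ⟨hij', g1', g2'⟩⟩)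
    · refine ⟨by omega, fun n hn => ?_⟩
      have g := g2 n hn
      by_cases hmk : n = k
      · subst hmk
        omega
      · rw [e n hmk]
        omega
    · have d2 : ((k + 1 : ℕ+) : ℕ) < j := hij'
      rw [PNat.add_coe, PNat.one_coe] at *
      rw [Nat.add_sub_cancel] at *
      refine ⟨by omega, fun n hn => ?_⟩
      rcases lt_trichotomy n k with c | c | c
      · have := g2 n c
        rw [e n (by omega)]
        omega
      · subst c
        omega
      · have := g2' n (by omega) hn
        rw [e n (by omega)]
        omega

theorem joined_shift (hk : k ∈ b) (hk1 : k + 1 ∉ b) (ha : a = symmDiff b {k, k + 1})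
    (i j : ℕ+) : Joined a i j ↔ Reconnect (Joined b) k (k + 1) i j := by
  refine joined_iff_reconnect (Or.inl (Or.inl (arc01_shift_self hk hk1 ha))) ?_ i j
  intro i j hi hi' hj hj'
  have fwd : ∀ {i j : ℕ+}, i ≠ k → i ≠ k + 1 → j ≠ k → j ≠ k + 1 → IsArc a i j →
      Joined b i j ∨ (Joined b i k ∧ Joined b (k + 1) j) ∨ (Joined b i (k + 1) ∧ Joined b k j) := by
    rintro i j hi hi' hj hj' (h | ⟨t, h1, h2⟩)
    · rcases (arc01_shift hk hk1 ha hi hi' hj hj').1 h with h | ⟨h, h'⟩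
      · exact Or.inl (Or.inl (Or.inl h))
      · exact Or.inr (Or.inl ⟨Or.inl (Or.inl h), Or.inl (Or.inl h')⟩)
    · rcases (first_shift hk hk1 ha hi hi').1 h1 with h1 | ⟨h1, h1'⟩ <;>
      rcases (first_shift hk hk1 ha hj hj').1 h2 with h2 | ⟨h2, h2'⟩
      · exact Or.inl (Or.inl (Or.inr ⟨t, h1, h2⟩))
      · exact Or.inr (Or.inl ⟨Or.inl (Or.inr ⟨t, h1, h2⟩), Or.inl (Or.inl h2')⟩)
      · exact Or.inr (Or.inr ⟨Or.inr (Or.inl h1'), Or.inl (Or.inr ⟨t, h1, h2⟩)⟩)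
      · have := h1.height_unique h2
        omega
  have bwd : ∀ {i j : ℕ+}, i ≠ k → i ≠ k + 1 → j ≠ k → j ≠ k + 1 → IsArc b i j → IsArc a i j := by
    rintro i j hi hi' hj hj' (h | ⟨t, h1, h2⟩)
    · exact Or.inl ((arc01_shift hk hk1 ha hi hi' hj hj').2 (Or.inl h))
    · exact Or.inr ⟨t, (first_shift hk hk1 ha hi hi').2 (Or.inl h1),
        (first_shift hk hk1 ha hj hj').2 (Or.inl h2)⟩
  -- The 0 at `k + 1` can only lie on a 01-arc. If `k` is on a 01-arc, the two arcs merge; if `k` is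
  -- on a 11-arc, `j` replaces it as a first passage of the same depth.
  have zig : ∀ {i j : ℕ+}, i ≠ k → i ≠ k + 1 → j ≠ k → j ≠ k + 1 → Joined b i k →
      Joined b (k + 1) j → Joined a i j := by
    intro i j hi hi' hj hj' h h'
    have h' := h'.arc01_of_notMem hk1
    rcases h.symm.cases_of_mem hk with h | ⟨t, h1, h2⟩ | ⟨t, h1, h2⟩
    · exact Or.inl (Or.inl ((arc01_shift hk hk1 ha hi hi' hj hj').2 (Or.inr ⟨h, h'⟩)))
    · exact Or.inr (Or.inr ⟨t, (first_shift hk hk1 ha hj hj').2 (Or.inr ⟨h1, h'⟩),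
        (first_shift hk hk1 ha hi hi').2 (Or.inl h2)⟩)
    · exact Or.inl (Or.inr ⟨t, (first_shift hk hk1 ha hi hi').2 (Or.inl h1),
        (first_shift hk hk1 ha hj hj').2 (Or.inr ⟨h2, h'⟩)⟩)
  constructor
  · rintro (h | h)
    · exact fwd hi hi' hj hj' h
    · rcases fwd hj hj' hi hi' h with h | ⟨h, h'⟩ | ⟨h, h'⟩
      · exact Or.inl h.symm
      · exact Or.inr (Or.inr ⟨h'.symm, h.symm⟩)
      · exact Or.inr (Or.inl ⟨h'.symm, h.symm⟩)
  · rintro ((h | h) | ⟨h, h'⟩ | ⟨h, h'⟩)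
    · exact Or.inl (bwd hi hi' hj hj' h)
    · exact Or.inr (bwd hj hj' hi hi' h)
    · exact zig hi hi' hj hj' h h'
    · exact (zig hj hj' hi hi' h'.symm h.symm).symm

end Shift

/-! ### Diagrams along the edges that create a pair of 1s -/

section Create
variable {a b : Finset ℕ+}

theorem ht_create_below (h1 : 1 ∉ b) (h2 : 2 ∉ b) :
    ht b 1 = 1 ∧ ht b 2 = 2 := by
  have e1 := ht_of_notMem h1
  have e2 := ht_of_notMem h2
  have : ht b 0 = 0 := rfl
  simp at e1 e2
  omega

theorem ht_create_above (h1 : 1 ∉ b) (h2 : 2 ∉ b) (ha : a = symmDiff b {1, 2}) :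
    ht a 1 = -1 ∧ ht a 2 = -2 := by
  have e1 := ht_of_mem (a := a) (k := 1) (by simp [ha, Finset.mem_symmDiff, h1])
  have e2 := ht_of_mem (a := a) (k := 2) (by simp [ha, Finset.mem_symmDiff, h2])
  have : ht a 0 = 0 := rfl
  simp at e1 e2
  omega

theorem ht_create (h1 : 1 ∉ b) (h2 : 2 ∉ b) (ha : a = symmDiff b {1, 2})
    {n : ℕ} (hn : 2 ≤ n) : ht a n = ht b n - 4 := by
  have b2 := (ht_create_below h1 h2).2
  have a2 := (ht_create_above h1 h2 ha).2
  induction n, hn using Nat.le_induction with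
  | base => omega
  | succ n hn ih =>
    have e1 : n.succPNat ≠ 1 := fun h => by
      have := congrArg PNat.val h
      simp at this
      omega
    have e2 : n.succPNat ≠ 2 := fun h => by
      have := congrArg PNat.val h
      change n + 1 = 2 at this
      omega
    have : n.succPNat ∈ a ↔ n.succPNat ∈ b := by simp [ha, Finset.mem_symmDiff, e1, e2]
    simp only [ht, this, ih]
    ring

theorem arc01_create (h1 : 1 ∉ b) (h2 : 2 ∉ b) (ha : a = symmDiff b {1, 2})
    {i j : ℕ+} (hi : 2 < (i : ℕ)) : Arc01 a i j ↔ Arc01 b i j := by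
  have e := fun n => ht_create h1 h2 ha (n := n)
  have ei := e (i - 1) (by omega)
  constructor
  · rintro ⟨hij, g1, g2⟩
    have hij' : (i : ℕ) < j := hij
    have ej := e j (by omega)
    refine ⟨hij, by omega, fun m hm hm' => ?_⟩
    have := g2 m hm hm'
    have := e m (by omega)
    omega
  · rintro ⟨hij, g1, g2⟩
    have hij' : (i : ℕ) < j := hij
    have ej := e j (by omega)
    refine ⟨hij, by omega, fun m hm hm' => ?_⟩
    have := g2 m hm hm'
    have := e m (by omega)
    omega

/-- Positions 1 and 2 take the depths 1 and 2. The lowered path reaches depths 3 and 4 where the old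
one returned to heights 1 and 0, at the partners of 2 and 1; old first passages move down by 4,
which preserves their pairing. -/
theorem first_create (h1 : 1 ∉ b) (h2 : 2 ∉ b) (ha : a = symmDiff b {1, 2})
    {m : ℤ} {j : ℕ+} (hj : 2 < (j : ℕ)) :
    First a m j ↔ (m = 3 ∧ Arc01 b 2 j) ∨ (m = 4 ∧ Arc01 b 1 j) ∨ First b (m - 4) j := by
  have e := fun n => ht_create h1 h2 ha (n := n)
  have ej := e j (by omega)
  obtain ⟨b1, b2⟩ := ht_create_below h1 h2
  obtain ⟨a1, a2⟩ := ht_create_above h1 h2 ha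
  have a0 : ht a 0 = 0 := rfl
  have b0 : ht b 0 = 0 := rfl
  constructor
  · rintro ⟨g1, g2⟩
    have hm := g2 2 hj
    by_cases h3 : m = 3
    · refine Or.inl ⟨h3, hj, ?_, fun n hn hn' => ?_⟩
      · change _ = ht b 1
        omega
      · change ht b 1 < _
        change 2 ≤ n at hn
        have := g2 n hn'
        have := e n hn
        omega
    by_cases h4 : m = 4
    · refine Or.inr (Or.inl ⟨h4, ?_, ?_, fun n hn hn' => ?_⟩)
      · change 1 < (j : ℕ)
        omega
      · change _ = ht b 0
        omega
      · change ht b 0 < _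
        change 1 ≤ n at hn
        rcases eq_or_lt_of_le hn with rfl | hn
        · omega
        have := g2 n hn'
        have := e n hn
        omega
    · refine Or.inr (Or.inr ⟨by omega, fun n hn => ?_⟩)
      rcases (by omega : n = 0 ∨ n = 1 ∨ 2 ≤ n) with rfl | rfl | hn2
      · omega
      · omega
      · have := g2 n hn
        have := e n hn2
        omega
  · rintro (⟨rfl, -, g1, g2⟩ | ⟨rfl, -, g1, g2⟩ | h)
    · change _ = ht b 1 at g1
      refine ⟨by omega, fun n hn => ?_⟩
      rcases (by omega : n = 0 ∨ n = 1 ∨ 2 ≤ n) with rfl | rfl | hn2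
      · omega
      · omega
      · have h : ht b 1 < _ := g2 n hn2 hn
        have := e n hn2
        omega
    · change _ = ht b 0 at g1
      refine ⟨by omega, fun n hn => ?_⟩
      rcases (by omega : n = 0 ∨ n = 1 ∨ 2 ≤ n) with rfl | rfl | hn2
      · omega
      · omega
      · have h : ht b 0 < _ := g2 n (show 1 ≤ n by omega) hn
        have := e n hn2
        omega
    · have hp := h.pos
      obtain ⟨g1, g2⟩ := h
      refine ⟨by omega, fun n hn => ?_⟩
      rcases (by omega : n = 0 ∨ n = 1 ∨ 2 ≤ n) with rfl | rfl | hn2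
      · omega
      · omega
      · have := g2 n hn
        have := e n hn2
        omega

theorem joined_create (h1 : 1 ∉ b) (h2 : 2 ∉ b) (ha : a = symmDiff b {1, 2})
    (i j : ℕ+) : Joined a i j ↔ Reconnect (Joined b) 1 2 i j := by
  obtain ⟨a1, a2⟩ := ht_create_above h1 h2 ha
  have a0 : ht a 0 = 0 := rfl
  have h12 : IsArc a 1 2 := by
    refine Or.inr ⟨0, ⟨by simpa using a1, fun n hn => ?_⟩, ⟨by simpa using a2, fun n hn => ?_⟩⟩
    · change n < 1 at hn
      obtain rfl : n = 0 := by omega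
      simp [a0]
    · change n < 2 at hn
      rcases (by omega : n = 0 ∨ n = 1) with rfl | rfl <;> simp [a0, a1]
  refine joined_iff_reconnect (Or.inl h12) ?_ i j
  intro i j hi hi' hj hj'
  have big : ∀ i : ℕ+, i ≠ 1 → i ≠ 2 → 2 < (i : ℕ) := by
    intro i h h'
    have := i.pos
    have g : (i : ℕ) ≠ 1 := fun e => h (PNat.coe_injective e)
    have g' : (i : ℕ) ≠ 2 := fun e => h' (PNat.coe_injective e)
    omega
  replace hi := big i hi hi'
  replace hj := big j hj hj'
  have fwd : ∀ {i j : ℕ+}, 2 < (i : ℕ) → 2 < (j : ℕ) → IsArc a i j →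
      Joined b i j ∨ (Joined b i 2 ∧ Joined b 1 j) := by
    rintro i j hi hj (h | ⟨t, g1, g2⟩)
    · exact Or.inl (Or.inl (Or.inl ((arc01_create h1 h2 ha hi).1 h)))
    · rcases (first_create h1 h2 ha hi).1 g1 with ⟨c, g1⟩ | ⟨c, g1⟩ | g1 <;>
      rcases (first_create h1 h2 ha hj).1 g2 with ⟨c', g2⟩ | ⟨c', g2⟩ | g2
      · omega
      · exact Or.inr ⟨Or.inr (Or.inl g1), Or.inl (Or.inl g2)⟩
      · have := g2.pos
        omega
      · omega
      · omega
      · omega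
      · omega
      · have := g1.pos
        omega
      · have := g1.pos
        refine Or.inl (Or.inl (Or.inr ⟨t - 2, ?_, ?_⟩))
        · convert g1 using 1
          omega
        · convert g2 using 1
          omega
  have bwd : ∀ {i j : ℕ+}, 2 < (i : ℕ) → 2 < (j : ℕ) → IsArc b i j → IsArc a i j := by
    rintro i j hi hj (h | ⟨t, g1, g2⟩)
    · exact Or.inl ((arc01_create h1 h2 ha hi).2 h)
    · refine Or.inr ⟨t + 2, (first_create h1 h2 ha hi).2 (Or.inr (Or.inr ?_)),
        (first_create h1 h2 ha hj).2 (Or.inr (Or.inr ?_))⟩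
      · convert g1 using 1
        push_cast
        ring
      · convert g2 using 1
        push_cast
        ring
  -- The old partners of 2 and 1 now have depths 3 and 4, hence form the 11-arc with `t = 1`.
  have zig : ∀ {i j : ℕ+}, 2 < (i : ℕ) → 2 < (j : ℕ) → Joined b i 2 → Joined b 1 j →
      Joined a i j := by
    intro i j hi hj h h'
    refine Or.inl (Or.inr ⟨1, (first_create h1 h2 ha hi).2 (Or.inl ⟨by norm_num, ?_⟩),
      (first_create h1 h2 ha hj).2 (Or.inr (Or.inl ⟨by norm_num, ?_⟩))⟩)
    · exact h.symm.arc01_of_notMem h2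
    · exact h'.arc01_of_notMem h1
  constructor
  · rintro (h | h)
    · exact (fwd hi hj h).imp_right Or.inr
    · rcases fwd hj hi h with h | ⟨h, h'⟩
      · exact Or.inl h.symm
      · exact Or.inr (Or.inl ⟨h'.symm, h.symm⟩)
  · rintro ((h | h) | ⟨h, h'⟩ | ⟨h, h'⟩)
    · exact Or.inl (bwd hi hj h)
    · exact Or.inr (bwd hj hi h)
    · exact (zig hj hi h'.symm h.symm).symm
    · exact zig hi hj h h'

end Create

end DKL

/-! ### Weights of hypercube vertices under reconnection. -/

namespace DKL

open scoped LaurentPolynomial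

noncomputable section

/-! ### Hypercubes of matchings -/

/-- The relation `M` pairs off some of the vertices. -/
structure IsMatching (M : ℕ+ → ℕ+ → Prop) : Prop where
  symm : ∀ {i j}, M i j → M j i
  unique : ∀ {i j j'}, M i j → M i j' → j = j'
  irrefl : ∀ i, ¬ M i i

theorem isMatching_joined (a : Finset ℕ+) : IsMatching (Joined a) where
  symm h := h.symm
  unique h h' := h.unique h'
  irrefl _ h := h.ne rfl

/-- The set `u` is a union of pairs of the matching `M`. -/
def Saturated (M : ℕ+ → ℕ+ → Prop) (u : Finset ℕ+) : Prop := ∀ i ∈ u, ∃ j ∈ u, M i j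

open Classical in
/-- The weight `v ^ d` of a union `u` of `d` pairs of the matching `M`; other sets have weight 0. -/
def weight (M : ℕ+ → ℕ+ → Prop) (u : Finset ℕ+) : ℤ[T;T⁻¹] :=
  if Saturated M u then LaurentPolynomial.T ((u.card / 2 : ℕ) : ℤ) else 0

section
variable {M : ℕ+ → ℕ+ → Prop} {x y : ℕ+} {u : Finset ℕ+}

theorem not_saturated_reconnect_left (hx : x ∈ u) (hy : y ∉ u) :
    ¬ Saturated (Reconnect M x y) u := by
  intro h
  obtain ⟨j, hj, h⟩ := h x hx
  rcases h with ⟨-, rfl⟩ | ⟨rfl, -⟩ | ⟨h, -⟩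
  exacts [hy hj, hy hx, h rfl]

theorem not_saturated_reconnect_right (hx : x ∉ u) (hy : y ∈ u) :
    ¬ Saturated (Reconnect M x y) u := by
  intro h
  obtain ⟨j, hj, h⟩ := h y hy
  rcases h with ⟨rfl, -⟩ | ⟨-, rfl⟩ | ⟨-, h, -⟩
  exacts [hx hy, hx hj, h rfl]

theorem saturated_reconnect_insert (hx : x ∉ u) (hy : y ∉ u) :
    Saturated (Reconnect M x y) (insert x (insert y u)) ↔ Saturated (Reconnect M x y) u := by
  constructor
  · intro h i hi
    obtain ⟨j, hj, h⟩ := h i (by simp [hi])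
    refine ⟨j, ?_, h⟩
    have h1 : i ≠ x := fun h => hx (h ▸ hi)
    have h2 : i ≠ y := fun h => hy (h ▸ hi)
    rcases h with ⟨h, -⟩ | ⟨h, -⟩ | ⟨-, -, h3, h4, -⟩
    · exact (h1 h).elim
    · exact (h2 h).elim
    · simpa [h3, h4] using hj
  · intro h i hi
    simp only [Finset.mem_insert] at hi
    rcases hi with rfl | rfl | hi
    · exact ⟨y, by simp, Or.inl ⟨rfl, rfl⟩⟩
    · exact ⟨x, by simp, Or.inr (Or.inl ⟨rfl, rfl⟩)⟩
    · obtain ⟨j, hj, h⟩ := h i hi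
      exact ⟨j, by simp [hj], h⟩

theorem exists_partners (hM : IsMatching M) (hxy : ¬ M x y)
    (h : Saturated M (insert x (insert y u))) :
    (∃ i ∈ u, M x i) ∧ ∃ j ∈ u, M y j := by
  obtain ⟨i, hi, hxi⟩ := h x (by simp)
  obtain ⟨j, hj, hyj⟩ := h y (by simp)
  simp only [Finset.mem_insert] at hi hj
  constructor
  · refine ⟨i, ?_, hxi⟩
    rcases hi with rfl | rfl | hi
    exacts [(hM.irrefl _ hxi).elim, (hxy hxi).elim, hi]
  · refine ⟨j, ?_, hyj⟩
    rcases hj with rfl | rfl | hj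
    exacts [(hxy (hM.symm hyj)).elim, (hM.irrefl _ hyj).elim, hj]

/-- The partner of `x` lies in `u`, but `x` does not. -/
theorem not_saturated_of_saturated_insert (hM : IsMatching M) (hxy : ¬ M x y) (hx : x ∉ u)
    (h : Saturated M (insert x (insert y u))) :
    ¬ Saturated M u := by
  intro h'
  obtain ⟨⟨i, hi, hxi⟩, -⟩ := exists_partners hM hxy h
  obtain ⟨j, hj, hij⟩ := h' i hi
  exact hx (hM.unique hij (hM.symm hxi) ▸ hj)

/-- The only new pair away from `x` and `y` consists of their former partners. The alternatives are
whether `u` contains this pair. -/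
theorem saturated_reconnect (hM : IsMatching M) (hxy : ¬ M x y) (hx : x ∉ u) (hy : y ∉ u) :
    Saturated (Reconnect M x y) u ↔ Saturated M (insert x (insert y u)) ∨ Saturated M u := by
  have hne : ∀ i ∈ u, i ≠ x ∧ i ≠ y := fun i hi => ⟨fun h => hx (h ▸ hi), fun h => hy (h ▸ hi)⟩
  constructor
  · intro h
    have hp : ∀ i ∈ u, ∃ j ∈ u, M i j ∨ (M i x ∧ M y j) ∨ (M i y ∧ M x j) := by
      intro i hi
      obtain ⟨j, hj, h⟩ := h i hi
      refine ⟨j, hj, ?_⟩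
      rcases h with ⟨h, -⟩ | ⟨h, -⟩ | ⟨-, -, -, -, h⟩
      exacts [((hne i hi).1 h).elim, ((hne i hi).2 h).elim, h]
    by_cases hc : ∃ i ∈ u, ∃ j ∈ u, M i x ∧ M y j
    · obtain ⟨i, hi, j, hj, h1, h2⟩ := hc
      left
      intro l hl
      simp only [Finset.mem_insert] at hl
      rcases hl with rfl | rfl | hl
      · exact ⟨i, by simp [hi], hM.symm h1⟩
      · exact ⟨j, by simp [hj], h2⟩
      · obtain ⟨m, hm, h | ⟨h, -⟩ | ⟨h, -⟩⟩ := hp l hl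
        · exact ⟨m, by simp [hm], h⟩
        · exact ⟨x, by simp, h⟩
        · exact ⟨y, by simp, h⟩
    · right
      intro i hi
      obtain ⟨j, hj, h | ⟨h, h'⟩ | ⟨h, h'⟩⟩ := hp i hi
      · exact ⟨j, hj, h⟩
      · exact (hc ⟨i, hi, j, hj, h, h'⟩).elim
      · exact (hc ⟨j, hj, i, hi, hM.symm h', hM.symm h⟩).elim
  · rintro (h | h) i hi
    · obtain ⟨⟨p, hp, hxp⟩, ⟨q, hq, hyq⟩⟩ := exists_partners hM hxy h
      have mk : ∀ j ∈ u, (M i j ∨ (M i x ∧ M y j) ∨ (M i y ∧ M x j)) →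
          ∃ j ∈ u, Reconnect M x y i j := fun j hj hj' =>
        ⟨j, hj, Or.inr (Or.inr ⟨(hne i hi).1, (hne i hi).2, (hne j hj).1, (hne j hj).2, hj'⟩)⟩
      obtain ⟨j, hj, hij⟩ := h i (by simp [hi])
      simp only [Finset.mem_insert] at hj
      rcases hj with rfl | rfl | hj
      · exact mk q hq (Or.inr (Or.inl ⟨hij, hyq⟩))
      · exact mk p hp (Or.inr (Or.inr ⟨hij, hxp⟩))
      · exact mk j hj (Or.inl hij)
    · obtain ⟨j, hj, hij⟩ := h i hi
      exact ⟨j, hj, Or.inr (Or.inr ⟨(hne i hi).1, (hne i hi).2, (hne j hj).1, (hne j hj).2,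
        Or.inl hij⟩)⟩

/-- At most one summand is nonzero. In the first, two old pairs merge into one on removal of `x` and
`y`, which accounts for the factor `T (-1)`. -/
theorem weight_reconnect (hM : IsMatching M) (hxy : ¬ M x y) (hx : x ∉ u) (hy : y ∉ u)
    (hne : x ≠ y) : weight (Reconnect M x y) u =
    LaurentPolynomial.T (-1) * weight M (insert x (insert y u)) + weight M u := by
  have hcard : (insert x (insert y u)).card = u.card + 2 := by
    rw [Finset.card_insert_of_notMem (by simp [hne, hx]), Finset.card_insert_of_notMem hy]
  have hd : (insert x (insert y u)).card / 2 = u.card / 2 + 1 := by omega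
  have hs := saturated_reconnect hM hxy hx hy
  simp only [weight, hd]
  by_cases h1 : Saturated M (insert x (insert y u))
  · have h2 := not_saturated_of_saturated_insert hM hxy hx h1
    rw [if_pos (hs.2 (Or.inl h1)), if_pos h1, if_neg h2, ← LaurentPolynomial.T_add, add_zero]
    congr 1
    push_cast
    ring
  · by_cases h2 : Saturated M u
    · rw [if_pos (hs.2 (Or.inr h2)), if_neg h1, if_pos h2, mul_zero, zero_add]
    · rw [if_neg (fun h => (hs.1 h).elim h1 h2), if_neg h1, if_neg h2, mul_zero, zero_add]

theorem weight_reconnect_insert (hM : IsMatching M) (hxy : ¬ M x y) (hx : x ∉ u) (hy : y ∉ u)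
    (hne : x ≠ y) :
    weight (Reconnect M x y) (insert x (insert y u)) =
      LaurentPolynomial.T 1 * weight M u + weight M (insert x (insert y u)) := by
  have hcard : (insert x (insert y u)).card = u.card + 2 := by
    rw [Finset.card_insert_of_notMem (by simp [hne, hx]), Finset.card_insert_of_notMem hy]
  have hd : (insert x (insert y u)).card / 2 = u.card / 2 + 1 := by omega
  -- Here `x` and `y` form one further pair of the new matching, which contributes a factor v.
  have h : weight (Reconnect M x y) (insert x (insert y u)) =
      LaurentPolynomial.T 1 * weight (Reconnect M x y) u := by
    have hs := saturated_reconnect_insert (M := M) hx hy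
    simp only [weight, hd]
    by_cases hu : Saturated (Reconnect M x y) u
    · rw [if_pos hu, if_pos (hs.2 hu)]
      rw [← LaurentPolynomial.T_add]
      congr 1
      push_cast
      ring
    · rw [if_neg hu, if_neg fun h => hu (hs.1 h), mul_zero]
  rw [h, weight_reconnect hM hxy hx hy hne, mul_add, ← mul_assoc,
    ← LaurentPolynomial.T_add]
  simp [add_comm]

end

/-! ### Depth in the hypercube of a diagram -/

theorem AtDepth.saturated {a b : Finset ℕ+} {d : ℕ} (h : AtDepth a b d) :
    Saturated (Joined a) (symmDiff a b) ∧ (symmDiff a b).card / 2 = d := by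
  obtain ⟨S, hS, rfl, rfl⟩ := h
  rw [symmDiff_symmDiff_cancel_left]
  constructor
  · intro i hi
    simp only [Finset.mem_biUnion, Finset.mem_insert, Finset.mem_singleton] at hi ⊢
    obtain ⟨p, hp, hi⟩ := hi
    have hJ : IsArc a p.1 p.2 := mem_arcs.1 (hS hp)
    rcases hi with rfl | rfl
    · exact ⟨p.2, ⟨p, hp, Or.inr rfl⟩, Or.inl hJ⟩
    · exact ⟨p.1, ⟨p, hp, Or.inl rfl⟩, Or.inr hJ⟩
  · rw [Finset.card_biUnion, Finset.sum_const_nat (m := 2)]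
    · simp
    · intro p hp
      have hJ : IsArc a p.1 p.2 := mem_arcs.1 (hS hp)
      exact Finset.card_pair hJ.lt.ne
    · intro p hp q hq hpq
      have hp' : IsArc a p.1 p.2 := mem_arcs.1 (hS hp)
      have hq' : IsArc a q.1 q.2 := mem_arcs.1 (hS hq)
      obtain ⟨p1, p2⟩ := p
      obtain ⟨q1, q2⟩ := q
      dsimp only at hp' hq'
      rw [Function.onFun, Finset.disjoint_left]
      intro k hk hk'
      simp only [Finset.mem_insert, Finset.mem_singleton] at hk hk'
      have l1 := hp'.lt
      have l2 := hq'.lt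
      rcases hk with rfl | rfl <;> rcases hk' with rfl | rfl
      · exact hpq (by rw [Joined.unique (Or.inl hp') (Or.inl hq')])
      · have := Joined.unique (Or.inl hp') (Or.inr hq')
        subst this
        exact (l1.trans l2).false
      · have := Joined.unique (Or.inr hp') (Or.inl hq')
        subst this
        exact (l1.trans l2).false
      · exact hpq (by rw [Joined.unique (Or.inr hp') (Or.inr hq')])

theorem Saturated.exists_atDepth {a b : Finset ℕ+} (h : Saturated (Joined a) (symmDiff a b)) :
    ∃ d, AtDepth a b d := by
  classical
  set u := symmDiff a b with hu
  -- The arcs to flip are those with both ends in `u`.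
  refine ⟨_, (u ×ˢ u).filter (fun p => IsArc a p.1 p.2), ?_, rfl, ?_⟩
  · intro p hp
    simp only [Finset.coe_filter, Set.mem_ofPred_eq] at hp
    exact mem_arcs.2 hp.2
  · rw [← symmDiff_symmDiff_cancel_left a b, ← hu]
    congr 1
    ext k
    simp only [Finset.mem_biUnion, Finset.mem_filter, Finset.mem_product, Finset.mem_insert,
      Finset.mem_singleton]
    constructor
    · intro hk
      obtain ⟨j, hj, h | h⟩ := h k hk
      · exact ⟨(k, j), ⟨⟨hk, hj⟩, h⟩, Or.inl rfl⟩
      · exact ⟨(j, k), ⟨⟨hj, hk⟩, h⟩, Or.inr rfl⟩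
    · rintro ⟨p, ⟨⟨h1, h2⟩, -⟩, rfl | rfl⟩
      · exact h1
      · exact h2

theorem AtDepth.weight_eq {a b : Finset ℕ+} {d : ℕ} (h : AtDepth a b d) :
    weight (Joined a) (symmDiff a b) = LaurentPolynomial.T (d : ℤ) := by
  rw [weight, if_pos h.saturated.1, h.saturated.2]

theorem weight_eq_zero_of_not_atDepth {a b : Finset ℕ+} (h : ¬ ∃ d, AtDepth a b d) :
    weight (Joined a) (symmDiff a b) = 0 := by
  rw [weight, if_neg fun hs => h hs.exists_atDepth]

/-- Only `a` itself has depth 0. This makes the correction terms of the recursion vanish. -/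
theorem coeff_zero_weight {a b : Finset ℕ+} (h : a ≠ b) :
    (weight (Joined a) (symmDiff a b)).coeff 0 = 0 := by
  by_cases hd : ∃ d, AtDepth a b d
  · obtain ⟨d, hd⟩ := hd
    rw [hd.weight_eq, LaurentPolynomial.T]
    have : d ≠ 0 := by
      rintro rfl
      obtain ⟨S, -, hS, rfl⟩ := hd
      rw [Finset.card_eq_zero.1 hS] at h
      exact h (symmDiff_bot a).symm
    simp [this]
  · rw [weight_eq_zero_of_not_atDepth hd]
    rfl

end

end DKL

/-! ### The group 𝒟 as signed permutations; alcoves, labels and lengths. -/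

namespace DKL

noncomputable section

open Equiv (Perm swap)

/-! ### Signed permutations -/

/-- The linear map `w` permutes the coordinates by `σ`, after a change of the signs of the
coordinates in `a`, which are even in number. -/
def Signed (w : Space ≃ₗ[ℝ] Space) (σ : Perm ℕ+) (a : Finset ℕ+) : Prop :=
  Even a.card ∧ ∀ x k, w x k = if σ k ∈ a then -x (σ k) else x (σ k)

theorem even_card_symmDiff {a b : Finset ℕ+} (ha : Even a.card) (hb : Even b.card) :
    Even (symmDiff a b).card := by
  have h1 := Finset.card_sdiff_add_card_inter a b
  have h2 := Finset.card_sdiff_add_card_inter b a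
  rw [Finset.inter_comm] at h2
  have h3 : (symmDiff a b).card = (a \ b).card + (b \ a).card := by
    rw [symmDiff_def, Finset.sup_eq_union, Finset.card_union_of_disjoint disjoint_sdiff_sdiff]
  rw [Nat.even_iff] at *
  omega

theorem Signed.one : Signed 1 1 ∅ := ⟨by simp, fun x k => by simp⟩

theorem Signed.mul {w w' : Space ≃ₗ[ℝ] Space} {σ σ' : Perm ℕ+} {a a' : Finset ℕ+}
    (h : Signed w σ a) (h' : Signed w' σ' a') :
    Signed (w * w') (σ' * σ) (symmDiff a' (a.map σ'.toEmbedding)) := by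
  refine ⟨even_card_symmDiff h'.1 (by simpa using h.1), fun x k => ?_⟩
  rw [LinearEquiv.mul_apply, h.2, h'.2, Perm.mul_apply]
  by_cases h1 : σ k ∈ a <;> by_cases h2 : σ' (σ k) ∈ a' <;> simp [Finset.mem_symmDiff, h1, h2]

theorem Signed.inv {w : Space ≃ₗ[ℝ] Space} {σ : Perm ℕ+} {a : Finset ℕ+} (h : Signed w σ a) :
    Signed w⁻¹ σ⁻¹ (a.map (σ⁻¹).toEmbedding) := by
  refine ⟨by simpa using h.1, fun x k => ?_⟩
  obtain ⟨y, rfl⟩ := w.surjective x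
  have : (w⁻¹ : Space ≃ₗ[ℝ] Space) (w y) = y := w.symm_apply_apply y
  rw [this, h.2]
  have hk : σ⁻¹ k ∈ a.map (σ⁻¹).toEmbedding ↔ k ∈ a := Finset.mem_map' (σ⁻¹).toEmbedding
  simp only [hk]
  by_cases hk : k ∈ a <;> simp [hk]

theorem Refl.signed (r : Refl) :
    Signed r.equiv (swap r.i r.j) (if r.neg then {r.i, r.j} else ∅) := by
  have hne : r.i ≠ r.j := ne_of_lt r.lt
  constructor
  · split_ifs
    · rw [Finset.card_pair hne]
      exact even_two
    · simp
  · intro x k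
    change r.map x k = _
    by_cases h1 : k = r.i
    · subst h1
      cases hn : r.neg <;> simp [Refl.map, hn]
    by_cases h2 : k = r.j
    · subst h2
      cases hn : r.neg <;> simp [Refl.map, hn, hne.symm]
    · cases hn : r.neg <;> simp [Refl.map, h1, h2, Equiv.swap_apply_of_ne_of_ne]

theorem exists_signed {w : Space ≃ₗ[ℝ] Space} (hw : w ∈ D) : ∃ σ a, Signed w σ a := by
  induction hw using Subgroup.closure_induction with
  | mem _ h =>
    obtain ⟨r, rfl⟩ := h
    exact ⟨_, _, r.signed⟩
  | one => exact ⟨_, _, Signed.one⟩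
  | mul _ _ _ _ h h' =>
    obtain ⟨_, _, h⟩ := h
    obtain ⟨_, _, h'⟩ := h'
    exact ⟨_, _, h.mul h'⟩
  | inv _ _ h =>
    obtain ⟨_, _, h⟩ := h
    exact ⟨_, _, h.inv⟩

theorem Refl.equiv_mem (r : Refl) : r.equiv ∈ D := Subgroup.subset_closure ⟨r, rfl⟩

theorem continuous_of_mem {w : Space ≃ₗ[ℝ] Space} (hw : w ∈ D) : Continuous w := by
  obtain ⟨σ, a, -, h⟩ := exists_signed hw
  refine continuous_pi fun k => ?_
  simp only [h]
  split_ifs <;> fun_prop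

theorem apply_inv_apply (w : Space ≃ₗ[ℝ] Space) (x : Space) : w (w⁻¹ x) = x :=
  w.apply_symm_apply x

theorem inv_apply_apply (w : Space ≃ₗ[ℝ] Space) (x : Space) : w⁻¹ (w x) = x :=
  w.symm_apply_apply x

/-! ### Conjugation of reflections -/

/-- The reflection for two indices in any order. -/
def Refl.mk' (i j : ℕ+) (h : i ≠ j) (neg : Bool) : Refl :=
  if hij : i < j then ⟨i, j, hij, neg⟩ else ⟨j, i, lt_of_le_of_ne (not_lt.1 hij) h.symm, neg⟩

theorem Refl.mk'_map {i j : ℕ+} (h : i ≠ j) (neg : Bool) (x : Space) (k : ℕ+) :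
    (Refl.mk' i j h neg).map x k =
      if k = i then (if neg then -x j else x j)
      else if k = j then (if neg then -x i else x i) else x k := by
  unfold Refl.mk'
  split_ifs <;> simp_all [Refl.map]

theorem Refl.mk'_form {i j : ℕ+} (h : i ≠ j) (neg : Bool) : ∃ c : ℝ, c * c = 1 ∧
    ∀ x : Space, (if neg then x i + x j else x i - x j) = c * (Refl.mk' i j h neg).form x := by
  unfold Refl.mk'
  by_cases hij : i < j
  · exact ⟨1, by norm_num, fun x => by simp [Refl.form, hij]⟩
  · cases neg
    · exact ⟨-1, by norm_num, fun x => by simp [Refl.form, hij]⟩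
    · exact ⟨1, by norm_num, fun x => by simp [Refl.form, hij, add_comm]⟩

/-- The conjugate reflection acts on the coordinates `σ t.i` and `σ t.j`; its type flips once for
each of them whose sign `w` changes. As `c` is 1 or -1, products of two values of a form keep their
sign. -/
theorem Signed.exists_conj {w : Space ≃ₗ[ℝ] Space} {σ : Perm ℕ+} {a : Finset ℕ+}
    (h : Signed w σ a) (t : Refl) : ∃ r : Refl, t.equiv * w = w * r.equiv ∧
      ∃ c : ℝ, c * c = 1 ∧ ∀ x, t.form (w x) = c * r.form x := by
  have hne : t.i ≠ t.j := ne_of_lt t.lt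
  have hne' : σ t.i ≠ σ t.j := fun h => hne (σ.injective h)
  refine ⟨Refl.mk' (σ t.i) (σ t.j) hne'
    (xor t.neg (xor (decide (σ t.i ∈ a)) (decide (σ t.j ∈ a)))), ?_, ?_⟩
  · refine LinearEquiv.ext fun x => funext fun k => ?_
    rw [LinearEquiv.mul_apply, LinearEquiv.mul_apply, h.2]
    change t.map (w x) k = if σ k ∈ a then -Refl.map _ x (σ k) else Refl.map _ x (σ k)
    rw [Refl.mk'_map]
    simp only [Refl.map, LinearMap.coe_mk, AddHom.coe_mk, h.2, EmbeddingLike.apply_eq_iff_eq]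
    by_cases h1 : k = t.i
    · subst h1
      cases t.neg <;> by_cases hi : σ t.i ∈ a <;> by_cases hj : σ t.j ∈ a <;> simp [hi, hj]
    by_cases h2 : k = t.j
    · subst h2
      cases t.neg <;> by_cases hi : σ t.i ∈ a <;> by_cases hj : σ t.j ∈ a <;>
        simp [hi, hj, hne.symm]
    · simp [h1, h2]
  · obtain ⟨c, hc, hf⟩ := Refl.mk'_form hne'
      (xor t.neg (xor (decide (σ t.i ∈ a)) (decide (σ t.j ∈ a))))
    refine ⟨if σ t.i ∈ a then -c else c, by split_ifs <;> linarith, fun x => ?_⟩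
    have := hf x
    have e : (if σ t.i ∈ a then -c else c) *
        (Refl.mk' (σ t.i) (σ t.j) hne'
          (xor t.neg (xor (decide (σ t.i ∈ a)) (decide (σ t.j ∈ a))))).form x =
        if σ t.i ∈ a then -(c * (Refl.mk' (σ t.i) (σ t.j) hne'
          (xor t.neg (xor (decide (σ t.i ∈ a)) (decide (σ t.j ∈ a))))).form x) else
          c * (Refl.mk' (σ t.i) (σ t.j) hne'
          (xor t.neg (xor (decide (σ t.i ∈ a)) (decide (σ t.j ∈ a))))).form x := by
      split_ifs <;> ring
    rw [e, ← this, Refl.form, h.2, h.2]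
    cases t.neg <;> by_cases hi : σ t.i ∈ a <;> by_cases hj : σ t.j ∈ a <;> simp [hi, hj] <;> ring

theorem exists_conj {w : Space ≃ₗ[ℝ] Space} (hw : w ∈ D) (t : Refl) :
    ∃ r : Refl, t.equiv * w = w * r.equiv ∧
      ∃ c : ℝ, c * c = 1 ∧ ∀ x, t.form (w x) = c * r.form x := by
  obtain ⟨σ, a, h⟩ := exists_signed hw
  exact h.exists_conj t

/-- The image of `vMinus` shows everything: the coordinates that move are the two indices, and the
sign there is the type. -/
theorem Refl.equiv_injective : Function.Injective Refl.equiv := by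
  intro r t h
  have key : ∀ r : Refl, ∀ k, r.equiv vMinus k ≠ vMinus k ↔ k = r.i ∨ k = r.j := by
    intro r k
    have hlt : (r.i : ℕ) < r.j := r.lt
    have hi : (0 : ℝ) < (r.i : ℕ) := by exact_mod_cast r.i.pos
    have hlt' : ((r.i : ℕ) : ℝ) < (r.j : ℕ) := by exact_mod_cast hlt
    have hne : r.j ≠ r.i := ne_of_gt r.lt
    change r.map vMinus k ≠ _ ↔ _
    simp only [Refl.map, LinearMap.coe_mk, AddHom.coe_mk, vMinus]
    by_cases h1 : k = r.i
    · subst h1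
      simp only [if_true, true_or, iff_true]
      split_ifs <;> intro h <;> linarith
    by_cases h2 : k = r.j
    · subst h2
      simp only [if_true, hne, if_false, or_true, iff_true]
      split_ifs <;> intro h <;> linarith
    · simp [h1, h2]
  have hs : ∀ k, (k = r.i ∨ k = r.j) ↔ (k = t.i ∨ k = t.j) := by
    intro k
    rw [← key, ← key, h]
  obtain ⟨i, j, hij, n⟩ := r
  obtain ⟨i', j', hij', n'⟩ := t
  simp only at hs
  have e1 := (hs i).1 (Or.inl rfl)
  have e2 := (hs j).1 (Or.inr rfl)
  have : i = i' ∧ j = j' := by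
    rcases e1 with rfl | rfl <;> rcases e2 with rfl | rfl
    · exact (lt_irrefl _ hij).elim
    · exact ⟨rfl, rfl⟩
    · exact (lt_asymm hij hij').elim
    · exact (lt_irrefl _ hij).elim
  obtain ⟨rfl, rfl⟩ := this
  have hv : Refl.map ⟨i, j, hij, n⟩ vMinus i = Refl.map ⟨i, j, hij', n'⟩ vMinus i :=
    congrFun (congrArg (fun w : Space ≃ₗ[ℝ] Space => w vMinus) h) i
  have hj : (0 : ℝ) < (j : ℕ) := by exact_mod_cast j.pos
  simp only [Refl.map, LinearMap.coe_mk, AddHom.coe_mk, if_true, vMinus] at hv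
  cases n <;> cases n' <;> simp at hv ⊢

/-! ### Cells -/

theorem apply_mem_cell {w : Space ≃ₗ[ℝ] Space} (hw : w ∈ D) {x y : Space}
    (h : x ∈ cell Set.univ y) : w x ∈ cell Set.univ (w y) := by
  intro t _
  obtain ⟨r, -, c, hc, hf⟩ := exists_conj hw t
  rw [hf, hf]
  have := h r trivial
  calc 0 < (c * c) * (r.form y * r.form x) := by rw [hc, one_mul]; exact this
    _ = _ := by ring

theorem image_fundAlcove {w : Space ≃ₗ[ℝ] Space} (hw : w ∈ D) :
    w '' fundAlcove = cell Set.univ (w vMinus) := by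
  ext x
  constructor
  · rintro ⟨y, hy, rfl⟩
    exact apply_mem_cell hw hy
  · intro h
    refine ⟨w⁻¹ x, ?_, apply_inv_apply w x⟩
    have := apply_mem_cell (D.inv_mem hw) h
    rwa [inv_apply_apply] at this

theorem form_vMinus_of_pos {r : Refl} (h : r.neg = false) : 0 < r.form vMinus := by
  have hlt : (r.i : ℕ) < r.j := r.lt
  have : ((r.i : ℕ) : ℝ) < (r.j : ℕ) := by exact_mod_cast hlt
  simp [Refl.form, h, vMinus, this]

theorem form_vMinus_of_neg {r : Refl} (h : r.neg = true) : r.form vMinus < 0 := by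
  have hi : (0 : ℝ) < (r.i : ℕ) := by exact_mod_cast r.i.pos
  have hj : (0 : ℝ) < (r.j : ℕ) := by exact_mod_cast r.j.pos
  simp only [Refl.form, h, vMinus, if_true]
  linarith

theorem vMinus_mem_fundAlcove : vMinus ∈ fundAlcove := by
  intro r _
  cases h : r.neg
  · exact mul_pos (form_vMinus_of_pos h) (form_vMinus_of_pos h)
  · exact mul_pos_of_neg_of_neg (form_vMinus_of_neg h) (form_vMinus_of_neg h)

theorem mem_fundChamber {x : Space} : x ∈ fundChamber ↔ StrictAnti x := by
  constructor
  · intro h i j hij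
    have h' := h ⟨i, j, hij, false⟩ rfl
    have := pos_of_mul_pos_right h' (form_vMinus_of_pos rfl).le
    simpa [Refl.form] using this
  · intro h r hr
    refine mul_pos (form_vMinus_of_pos hr) ?_
    have hr' : r.neg = false := hr
    simpa [Refl.form, hr'] using h r.lt

/-- In a descending sequence `x 1 + x 2` is the largest sum of two entries, so it controls all the
others. -/
theorem mem_fundAlcove {x : Space} : x ∈ fundAlcove ↔ StrictAnti x ∧ x 1 + x 2 < 0 := by
  constructor
  · intro h
    refine ⟨mem_fundChamber.1 fun r _ => h r trivial, ?_⟩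
    have h' := h ⟨1, 2, by decide, true⟩ trivial
    have := neg_of_mul_pos_right h' (form_vMinus_of_neg rfl).le
    simpa [Refl.form] using this
  · rintro ⟨h, h12⟩ r _
    cases hr : r.neg
    · refine mul_pos (form_vMinus_of_pos hr) ?_
      simpa [Refl.form, hr] using h r.lt
    · refine mul_pos_of_neg_of_neg (form_vMinus_of_neg hr) ?_
      have h1 : x r.i ≤ x 1 := h.antitone one_le
      have h2 : x r.j ≤ x 2 := h.antitone (by
        have := r.lt
        have : (r.i : ℕ) < r.j := this
        have := r.i.pos
        change 2 ≤ (r.j : ℕ)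
        omega)
      simp only [Refl.form, hr, if_true]
      linarith

theorem image_subset_fundChamber {w : Space ≃ₗ[ℝ] Space} (hw : w ∈ D) :
    w '' fundAlcove ⊆ fundChamber ↔ StrictAnti (w vMinus) := by
  rw [← mem_fundChamber]
  constructor
  · exact fun h => h ⟨_, vMinus_mem_fundAlcove, rfl⟩
  · intro h y hy r hr
    rw [image_fundAlcove hw] at hy
    have h1 := h r hr
    have h2 := hy r trivial
    have hv := form_vMinus_of_pos hr
    have h3 := pos_of_mul_pos_right h1 hv.le
    exact mul_pos hv (pos_of_mul_pos_right h2 h3.le)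

/-! ### Points of the orbit of `v₋` -/

/-- The entry of absolute value `n` of the points with set of positive entries `a`. -/
def entry (a : Finset ℕ+) (n : ℕ+) : ℤ := if n ∈ a then (n : ℕ) else -((n : ℕ) : ℤ)

theorem entry_injective (a : Finset ℕ+) : Function.Injective (entry a) := by
  intro m n h
  have := m.pos
  have := n.pos
  apply PNat.coe_injective
  unfold entry at h
  split_ifs at h <;> omega

theorem Signed.apply_vMinus {w : Space ≃ₗ[ℝ] Space} {σ : Perm ℕ+} {a : Finset ℕ+}
    (h : Signed w σ a) (k : ℕ+) : w vMinus k = (entry a (σ k) : ℝ) := by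
  rw [h.2, entry, vMinus]
  split_ifs <;> simp

/-- The set `a` fixes the set of entries of the image of `vMinus`, and a descending sequence is
fixed by its set of entries. As their absolute values are distinct, the permutation follows. -/
theorem Signed.ext_of_strictAnti {w w' : Space ≃ₗ[ℝ] Space} {σ σ' : Perm ℕ+} {a : Finset ℕ+}
    (h : Signed w σ a) (h' : Signed w' σ' a) (hw : StrictAnti (w vMinus))
    (hw' : StrictAnti (w' vMinus)) : w = w' := by
  have hr : ∀ {w : Space ≃ₗ[ℝ] Space} {σ : Perm ℕ+}, Signed w σ a →
      Set.range (w vMinus) = Set.range fun n => (entry a n : ℝ) := by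
    intro w σ h
    rw [show w vMinus = (fun n => (entry a n : ℝ)) ∘ σ from funext h.apply_vMinus,
      σ.surjective.range_comp]
  have he : w vMinus = w' vMinus := by
    have := (StrictMono.range_inj hw.neg hw'.neg).1 (by
      change Set.range (Neg.neg ∘ w vMinus) = Set.range (Neg.neg ∘ w' vMinus)
      rw [Set.range_comp, Set.range_comp, hr h, hr h'])
    exact neg_injective this
  have hσ : σ = σ' := by
    ext1 k
    have := congrFun he k
    rw [h.apply_vMinus, h'.apply_vMinus] at this
    exact entry_injective a (by exact_mod_cast this)
  subst hσ
  refine LinearEquiv.ext fun x => funext fun k => ?_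
  rw [h.2, h'.2]

/-- Descending with negative `x 1 + x 2` leaves at most one positive entry, the first; evenness of
the number of sign changes excludes it. -/
theorem eq_one_of_apply_vMinus_mem {u : Space ≃ₗ[ℝ] Space} (hu : u ∈ D)
    (h : u vMinus ∈ fundAlcove) : u = 1 := by
  obtain ⟨σ, a, hs⟩ := exists_signed hu
  obtain ⟨hanti, h12⟩ := mem_fundAlcove.1 h
  have ha : a = ∅ := by
    have hsub : a ⊆ {σ 1} := by
      intro n hn
      obtain ⟨k, rfl⟩ := σ.surjective n
      rw [Finset.mem_singleton, EmbeddingLike.apply_eq_iff_eq]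
      by_contra hk
      have h2 : (2 : ℕ+) ≤ k := by
        have := k.pos
        have : (k : ℕ) ≠ 1 := fun e => hk (PNat.coe_injective e)
        change 2 ≤ (k : ℕ)
        omega
      have h3 : u vMinus k ≤ u vMinus 2 := hanti.antitone h2
      have h4 : u vMinus 2 < u vMinus 1 := hanti (by decide)
      have h5 := hs.apply_vMinus k
      rw [entry, if_pos hn] at h5
      have h6 : (0 : ℝ) < ((σ k : ℕ) : ℤ) := by exact_mod_cast (σ k).pos
      linarith
    have hc := Finset.card_le_card hsub
    rw [Finset.card_singleton] at hc
    have := hs.1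
    rw [Nat.even_iff] at this
    exact Finset.card_eq_zero.1 (by omega)
  subst ha
  exact hs.ext_of_strictAnti Signed.one hanti (mem_fundAlcove.1 vMinus_mem_fundAlcove).1

theorem eq_of_apply_vMinus_mem {w w' : Space ≃ₗ[ℝ] Space} (hw : w ∈ D) (hw' : w' ∈ D)
    (h : w' vMinus ∈ w '' fundAlcove) : w' = w := by
  obtain ⟨y, hy, hyw⟩ := h
  have : (w⁻¹ * w') vMinus ∈ fundAlcove := by
    rw [LinearEquiv.mul_apply, ← hyw, inv_apply_apply]
    exact hy
  have := eq_one_of_apply_vMinus_mem (D.mul_mem (D.inv_mem hw) hw') this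
  exact (inv_mul_eq_one.1 this).symm

theorem eq_of_image_eq {w w' : Space ≃ₗ[ℝ] Space} (hw : w ∈ D) (hw' : w' ∈ D)
    (h : w '' fundAlcove = w' '' fundAlcove) : w = w' :=
  eq_of_apply_vMinus_mem hw' hw (h ▸ ⟨_, vMinus_mem_fundAlcove, rfl⟩)

/-! ### Dominant alcoves -/

theorem DomAlcove.exists_rep (A : DomAlcove) :
    ∃ w ∈ D, A.1 = w '' fundAlcove ∧ StrictAnti (w vMinus) := by
  obtain ⟨A, ⟨w, hw, rfl⟩, hA⟩ := A
  exact ⟨w, hw, rfl, (image_subset_fundChamber hw).1 hA⟩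

/-- The element of `𝒟` that takes the fundamental alcove to `A`. -/
def rep (A : DomAlcove) : Space ≃ₗ[ℝ] Space := A.exists_rep.choose

theorem rep_mem (A : DomAlcove) : rep A ∈ D := A.exists_rep.choose_spec.1

theorem image_rep (A : DomAlcove) : A.1 = rep A '' fundAlcove := A.exists_rep.choose_spec.2.1

theorem strictAnti_rep (A : DomAlcove) : StrictAnti (rep A vMinus) :=
  A.exists_rep.choose_spec.2.2

theorem rep_eq {A : DomAlcove} {w : Space ≃ₗ[ℝ] Space} (hw : w ∈ D)
    (h : A.1 = w '' fundAlcove) : rep A = w :=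
  eq_of_image_eq (rep_mem A) hw (by rw [← h, image_rep])

theorem rep_injective : Function.Injective rep := by
  intro A B h
  apply Subtype.ext
  rw [image_rep A, image_rep B, h]

/-- The alcove of an element of `𝒟` that takes `v₋` to a descending sequence. -/
def ofRep (w : Space ≃ₗ[ℝ] Space) (hw : w ∈ D) (h : StrictAnti (w vMinus)) : DomAlcove :=
  ⟨w '' fundAlcove, ⟨w, hw, rfl⟩, (image_subset_fundChamber hw).2 h⟩

theorem rep_ofRep {w : Space ≃ₗ[ℝ] Space} (hw : w ∈ D) (h : StrictAnti (w vMinus)) :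
    rep (ofRep w hw h) = w := rep_eq hw rfl

theorem DomAlcove.exists_perm_lab (A : DomAlcove) : ∃ p : Perm ℕ+ × Finset ℕ+,
    Signed (rep A) p.1 p.2 := by
  obtain ⟨σ, a, h⟩ := exists_signed (rep_mem A)
  exact ⟨(σ, a), h⟩

/-- The permutation of the coordinates that underlies `rep A`. -/
def perm (A : DomAlcove) : Perm ℕ+ := A.exists_perm_lab.choose.1

/-- The label of `A` as a finite set. -/
def lab (A : DomAlcove) : Finset ℕ+ := A.exists_perm_lab.choose.2

theorem signed_rep (A : DomAlcove) : Signed (rep A) (perm A) (lab A) :=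
  A.exists_perm_lab.choose_spec

theorem Signed.mem_iff {w : Space ≃ₗ[ℝ] Space} {σ : Perm ℕ+} {a : Finset ℕ+}
    (h : Signed w σ a) (n : ℕ+) : n ∈ a ↔ ∃ k, w vMinus k = ((n : ℕ) : ℝ) := by
  constructor
  · intro hn
    refine ⟨σ⁻¹ n, ?_⟩
    rw [h.apply_vMinus, entry]
    simp [hn]
  · rintro ⟨k, hk⟩
    rw [h.apply_vMinus] at hk
    have hk : entry a (σ k) = ((n : ℕ) : ℤ) := by exact_mod_cast hk
    have := n.pos
    unfold entry at hk
    split_ifs at hk with h'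
    · have : σ k = n := PNat.coe_injective (by exact_mod_cast hk)
      rwa [← this]
    · omega

theorem lab_eq {A : DomAlcove} {σ : Perm ℕ+} {a : Finset ℕ+} (h : Signed (rep A) σ a) :
    lab A = a := by
  ext n
  rw [(signed_rep A).mem_iff, h.mem_iff]

theorem label_eq_lab (A : DomAlcove) : label A = (lab A : Set ℕ+) := by
  ext n
  rw [Finset.mem_coe, (signed_rep A).mem_iff]
  constructor
  · rintro ⟨w, hw, hA, hk⟩
    rw [image_rep A] at hA
    rwa [← eq_of_apply_vMinus_mem (rep_mem A) hw hA]
  · intro hk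
    refine ⟨rep A, rep_mem A, ?_, hk⟩
    rw [image_rep A]
    exact ⟨_, vMinus_mem_fundAlcove, rfl⟩

theorem even_card_lab (A : DomAlcove) : Even (lab A).card := (signed_rep A).1

theorem lab_injective : Function.Injective lab := by
  intro A B h
  refine rep_injective ((signed_rep A).ext_of_strictAnti (σ' := perm B) ?_ (strictAnti_rep A)
    (strictAnti_rep B))
  rw [h]
  exact signed_rep B

/-! ### Lengths -/

/-- Each alcove lies on one side of every hyperplane, so one point of each decides. -/
theorem separates_iff {w : Space ≃ₗ[ℝ] Space} (hw : w ∈ D) (r : Refl) :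
    (∀ x ∈ w '' fundAlcove, ∀ y ∈ fundAlcove, r.form x * r.form y < 0) ↔
      r.form (w vMinus) * r.form vMinus < 0 := by
  constructor
  · exact fun h => h _ ⟨_, vMinus_mem_fundAlcove, rfl⟩ _ vMinus_mem_fundAlcove
  · intro h x hx y hy
    rw [image_fundAlcove hw] at hx
    have hx := hx r trivial
    have hy := hy r trivial
    have := mul_neg_of_neg_of_pos h (mul_pos hx hy)
    by_contra hc
    rw [not_lt] at hc
    have : 0 ≤ (r.form (w vMinus) * r.form vMinus) ^ 2 * (r.form x * r.form y) :=
      mul_nonneg (sq_nonneg _) hc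
    nlinarith

/-- By dominance only hyperplanes of the type `x_i + x_j = 0` separate, namely those with positive
sum of entries. If the absolute values are m > n, the sum is positive exactly if m is in the label,
so each such m counts m-1 times. -/
theorem length_eq (A : DomAlcove) : length A.1 = ∑ m ∈ lab A, ((m : ℕ) - 1) := by
  have hS := signed_rep A
  set a := lab A
  set σ := perm A
  have hcard : ((a.sigma fun m => Finset.Ico 1 m : Finset (Σ _ : ℕ+, ℕ+))).card =
      ∑ m ∈ a, ((m : ℕ) - 1) := by
    rw [Finset.card_sigma]
    exact Finset.sum_congr rfl fun m _ => PNat.card_Ico _ _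
  rw [← hcard, ← Set.ncard_coe_finset, length, image_rep A]
  simp only [separates_iff (rep_mem A)]
  have hmem : ∀ r : Refl, r.form (rep A vMinus) * r.form vMinus < 0 ↔
      r.neg = true ∧ 0 < entry a (σ r.i) + entry a (σ r.j) := by
    intro r
    cases hr : r.neg
    · have h1 := form_vMinus_of_pos hr
      have h2 : 0 < r.form (rep A vMinus) := by
        simpa [Refl.form, hr] using strictAnti_rep A r.lt
      simpa using (mul_pos h2 h1).le
    · have h1 := form_vMinus_of_neg hr
      have h2 : r.form (rep A vMinus) = ((entry a (σ r.i) + entry a (σ r.j) : ℤ) : ℝ) := by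
        simp [Refl.form, hr, hS.apply_vMinus]
      rw [h2]
      constructor
      · intro h
        refine ⟨rfl, ?_⟩
        have := pos_of_mul_neg_left h h1.le
        exact_mod_cast this
      · rintro ⟨-, h⟩
        exact mul_neg_of_pos_of_neg (by exact_mod_cast h) h1
  simp only [hmem]
  refine Set.ncard_congr (fun r _ => ⟨max (σ r.i) (σ r.j), min (σ r.i) (σ r.j)⟩) ?_ ?_ ?_
  · rintro r ⟨-, hr⟩
    have hne : σ r.i ≠ σ r.j := fun h => r.lt.ne (σ.injective h)
    simp only [Finset.coe_sigma, Set.mem_sigma_iff, Finset.mem_coe, Finset.mem_Ico, one_le,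
      true_and]
    refine ⟨?_, min_lt_max.2 hne⟩
    rcases lt_or_gt_of_ne hne with hlt | hlt
    · rw [max_eq_right hlt.le]
      have hlt : (σ r.i : ℕ) < σ r.j := hlt
      by_contra hc
      unfold entry at hr
      rw [if_neg hc] at hr
      split_ifs at hr <;> omega
    · rw [max_eq_left hlt.le]
      have hlt : (σ r.j : ℕ) < σ r.i := hlt
      by_contra hc
      unfold entry at hr
      rw [if_neg hc] at hr
      split_ifs at hr <;> omega
  · rintro ⟨i, j, hij, n⟩ ⟨i', j', hij', n'⟩ ⟨hn, -⟩ ⟨hn', -⟩ h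
    simp only at hn hn'
    subst hn hn'
    simp only [Sigma.mk.injEq, heq_eq_eq] at h
    obtain ⟨h1, h2⟩ := h
    have : (σ i = σ i' ∧ σ j = σ j') ∨ (σ i = σ j' ∧ σ j = σ i') := by
      rcases le_total (σ i) (σ j) with c | c <;> rcases le_total (σ i') (σ j') with c' | c' <;>
        simp only [max_eq_left, max_eq_right, min_eq_left, min_eq_right, c, c'] at h1 h2 <;> tauto
    simp only [EmbeddingLike.apply_eq_iff_eq] at this
    rcases this with ⟨rfl, rfl⟩ | ⟨rfl, rfl⟩
    · rfl
    · exact (lt_asymm hij hij').elim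
  · rintro ⟨m, n⟩ hmn
    simp only [Finset.coe_sigma, Set.mem_sigma_iff, Finset.mem_coe, Finset.mem_Ico, one_le,
      true_and] at hmn
    obtain ⟨hm, hlt⟩ := hmn
    have hlt' : (n : ℕ) < m := hlt
    have hpos : 0 < entry a m + entry a n := by
      unfold entry
      rw [if_pos hm]
      split_ifs <;> omega
    have hne : σ⁻¹ m ≠ σ⁻¹ n := fun h => hlt.ne' (σ⁻¹.injective h)
    rcases lt_or_gt_of_ne hne with c | c
    · refine ⟨⟨σ⁻¹ m, σ⁻¹ n, c, true⟩, ⟨rfl, by simpa using hpos⟩, ?_⟩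
      simp [hlt.le]
    · refine ⟨⟨σ⁻¹ n, σ⁻¹ m, c, true⟩, ⟨rfl, by simpa [add_comm] using hpos⟩, ?_⟩
      simp [hlt.le]

end

end DKL

/-! ### Edges as toggles of the label, and the recursion. -/

namespace DKL

open scoped LaurentPolynomial

noncomputable section

open Equiv (Perm swap)

/-! ### Walls -/

/-- The reflections in the walls of the fundamental alcove: `(1 2)₋` and the `(k k+1)`. -/
def simple : Option ℕ+ → Refl
  | none => ⟨1, 2, by decide, true⟩
  | some k => ⟨k, k + 1, PNat.lt_add_right k 1, false⟩

theorem closure_fundAlcove_subset {x : Space} (hx : x ∈ closure fundAlcove) :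
    Antitone x ∧ x 1 + x 2 ≤ 0 := by
  constructor
  · intro i j hij
    exact closure_minimal (fun y hy => (mem_fundAlcove.1 hy).1.antitone hij)
      (isClosed_le (continuous_apply j) (continuous_apply i)) hx
  · exact closure_minimal (fun y hy => (mem_fundAlcove.1 hy).2.le)
      (isClosed_le ((continuous_apply 1).add (continuous_apply 2)) continuous_const) hx

theorem mem_closure_fundAlcove {x : Space} (hx : Antitone x) (h12 : x 1 + x 2 ≤ 0) :
    x ∈ closure fundAlcove := by
  have hc : Continuous fun δ : ℝ => x + δ • vMinus := by fun_prop
  have ht : Filter.Tendsto (fun δ : ℝ => x + δ • vMinus) (nhdsWithin 0 (Set.Ioi 0)) (nhds x) := by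
    have := (hc.tendsto 0).mono_left (nhdsWithin_le_nhds (s := Set.Ioi 0))
    simpa using this
  refine mem_closure_of_tendsto ht ?_
  filter_upwards [self_mem_nhdsWithin] with δ hδ
  have hδ : 0 < δ := hδ
  obtain ⟨hv, hv12⟩ := mem_fundAlcove.1 vMinus_mem_fundAlcove
  refine mem_fundAlcove.2 ⟨fun i j hij => ?_, ?_⟩
  · have h1 := hx hij.le
    have h2 := mul_lt_mul_of_pos_left (hv hij) hδ
    simp only [Pi.add_apply, Pi.smul_apply, smul_eq_mul]
    linarith
  · have := mul_neg_of_pos_of_neg hδ hv12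
    simp only [Pi.add_apply, Pi.smul_apply, smul_eq_mul]
    linarith

/-- On the closure the inequalities squeeze: `x i = x j` forces `x i = x (i + 1)`, and `x i + x j =
0` forces `x 1 + x 2 = 0`, so any other wall point would lie on a simple hyperplane too. -/
theorem exists_eq_simple_of_isWall {t : Refl} (h : IsWall t fundAlcove) : ∃ s, t = simple s := by
  obtain ⟨x, hx, ht, hr⟩ := h
  obtain ⟨hanti, h12⟩ := closure_fundAlcove_subset hx
  obtain ⟨i, j, hij, n⟩ := t
  have hij' : (i : ℕ) < j := hij
  have := i.pos
  cases n
  · refine ⟨some i, ?_⟩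
    by_contra hne
    refine hr (simple (some i)) (Ne.symm hne) ?_
    have ht' : x i - x j = 0 := by simpa [Refl.form] using ht
    have h1 : x (i + 1) ≤ x i := hanti (PNat.lt_add_right i 1).le
    have h2 : x j ≤ x (i + 1) := hanti hij
    simp only [simple, Refl.form, Bool.false_eq_true, if_false]
    linarith
  · refine ⟨none, ?_⟩
    by_contra hne
    refine hr (simple none) (Ne.symm hne) ?_
    have ht' : x i + x j = 0 := by simpa [Refl.form] using ht
    have h1 : x i ≤ x 1 := hanti one_le
    have h2 : x j ≤ x 2 := hanti (show 2 ≤ (j : ℕ) by omega)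
    simp only [simple, Refl.form, if_true]
    linarith

theorem isWall_simple (s : Option ℕ+) : IsWall (simple s) fundAlcove := by
  rcases s with - | k
  · refine ⟨Function.update vMinus 1 2, mem_closure_fundAlcove ?_ ?_, ?_, ?_⟩
    · intro i j hij
      have hij' : ((i : ℕ) : ℝ) ≤ (j : ℕ) := by exact_mod_cast hij
      have hj : (0 : ℝ) < (j : ℕ) := by exact_mod_cast j.pos
      by_cases hi : i = 1 <;> by_cases hj : j = 1
      · simp [hi, hj]
      · simp only [hi, Function.update_self, Function.update_of_ne hj, vMinus]
        linarith
      · exact (hi (le_antisymm (hj ▸ hij) one_le)).elim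
      · simp only [Function.update_of_ne hi, Function.update_of_ne hj, vMinus]
        linarith
    · simp [vMinus]
    · simp [simple, Refl.form, vMinus]
    · rintro ⟨i, j, hij, n⟩ hne h
      have hij' : (i : ℕ) < j := hij
      have hip := i.pos
      have hj1 : j ≠ 1 := by
        rintro rfl
        change (i : ℕ) < 1 at hij'
        omega
      by_cases hi : i = 1
      · subst hi
        cases n
        · simp only [Refl.form, Bool.false_eq_true, if_false, Function.update_self,
            Function.update_of_ne hj1, vMinus] at h
          have : (0 : ℝ) < (j : ℕ) := by exact_mod_cast j.pos
          linarith
        · simp only [Refl.form, if_true, Function.update_self,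
            Function.update_of_ne hj1, vMinus] at h
          have : ((j : ℕ) : ℝ) = (2 : ℕ) := by push_cast; linarith
          obtain rfl : j = 2 := PNat.coe_injective (by exact_mod_cast this)
          exact hne rfl
      · have h1 : (0 : ℝ) < (i : ℕ) := by exact_mod_cast hip
        have h2 : ((i : ℕ) : ℝ) < (j : ℕ) := by exact_mod_cast hij'
        cases n <;> simp only [Refl.form, Bool.false_eq_true, if_false, if_true,
            Function.update_of_ne hi, Function.update_of_ne hj1, vMinus] at h <;> linarith
  · have hk : (0 : ℝ) < (k : ℕ) := by exact_mod_cast k.pos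
    have hk1 : k ≠ k + 1 := (PNat.lt_add_right k 1).ne
    have hv : ∀ i : ℕ+, Function.update vMinus (k + 1) (-((k : ℕ) : ℝ)) i =
        -(((if (i : ℕ) = k + 1 then (k : ℕ) else i : ℕ)) : ℝ) := by
      intro i
      by_cases hi : i = k + 1
      · subst hi
        simp
      · have : (i : ℕ) ≠ k + 1 := fun e => hi (PNat.coe_injective (by simpa using e))
        rw [Function.update_of_ne hi, if_neg this, vMinus]
    refine ⟨Function.update vMinus (k + 1) (-((k : ℕ) : ℝ)), mem_closure_fundAlcove ?_ ?_, ?_, ?_⟩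
    · intro i j hij
      have hij' : (i : ℕ) ≤ j := hij
      rw [hv, hv]
      refine neg_le_neg (Nat.cast_le.2 ?_)
      split_ifs <;> omega
    · rw [hv, hv]
      have : ∀ m n : ℕ, -(m : ℝ) + -(n : ℝ) ≤ 0 := fun m n => by
        have := m.cast_nonneg (α := ℝ)
        have := n.cast_nonneg (α := ℝ)
        linarith
      exact this _ _
    · simp [simple, Refl.form, Function.update_of_ne hk1, vMinus]
    · rintro ⟨i, j, hij, n⟩ hne h
      have hij' : (i : ℕ) < j := hij
      have hip := i.pos
      have hkp := k.pos
      cases n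
      · simp only [Refl.form, Bool.false_eq_true, if_false, hv] at h
        have h : (if (i : ℕ) = k + 1 then (k : ℕ) else i) =
            if (j : ℕ) = k + 1 then (k : ℕ) else j := by
          have := sub_eq_zero.1 h
          have := neg_injective this
          exact_mod_cast this
        have hc : (i : ℕ) = k ∧ (j : ℕ) = k + 1 := by split_ifs at h <;> omega
        obtain rfl : i = k := PNat.coe_injective hc.1
        obtain rfl : j = i + 1 := PNat.coe_injective (by simpa using hc.2)
        exact hne rfl
      · simp only [Refl.form, if_true, hv] at h
        have h : (if (i : ℕ) = k + 1 then (k : ℕ) else i) +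
            (if (j : ℕ) = k + 1 then (k : ℕ) else j) = 0 := by
          have h' : ∀ m n : ℕ, -(m : ℝ) + -(n : ℝ) = 0 → m + n = 0 := fun m n h => by
            have : (m : ℝ) + n = 0 := by linarith
            exact_mod_cast this
          exact h' _ _ h
        split_ifs at h <;> omega

theorem closure_image {w : Space ≃ₗ[ℝ] Space} (hw : w ∈ D) (A : Set Space) :
    closure (w '' A) = w '' closure A := by
  let e : Space ≃ₜ Space :=
    { toEquiv := w.toEquiv
      continuous_toFun := continuous_of_mem hw
      continuous_invFun := continuous_of_mem (D.inv_mem hw) }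
  exact (e.image_closure A).symm

theorem isWall_image {w : Space ≃ₗ[ℝ] Space} (hw : w ∈ D) {t r : Refl}
    (h : t.equiv * w = w * r.equiv) {A : Set Space} (hr : IsWall r A) : IsWall t (w '' A) := by
  have hu : ∀ {t t' r : Refl}, t.equiv * w = w * r.equiv → t'.equiv * w = w * r.equiv → t = t' :=
    fun h h' => Refl.equiv_injective (mul_right_cancel (h.trans h'.symm))
  have hu' : ∀ {t r r' : Refl}, t.equiv * w = w * r.equiv → t.equiv * w = w * r'.equiv → r = r' :=
    fun h h' => Refl.equiv_injective (mul_left_cancel (h.symm.trans h'))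
  obtain ⟨y, hy, h0, hne⟩ := hr
  refine ⟨w y, closure_image hw A ▸ ⟨y, hy, rfl⟩, ?_, fun t' ht' h0' => ?_⟩
  · obtain ⟨r', hr', c, hc, hf⟩ := exists_conj hw t
    rw [hf, ← hu' h hr', h0, mul_zero]
  · obtain ⟨r', hr', c, hc, hf⟩ := exists_conj hw t'
    rw [hf] at h0'
    refine hne r' ?_ ?_
    · rintro rfl
      exact ht' (hu hr' h)
    · rcases mul_eq_zero.1 h0' with h | h
      · rw [h] at hc
        norm_num at hc
      · exact h

theorem image_mul (w w' : Space ≃ₗ[ℝ] Space) (A : Set Space) : (w * w') '' A = w '' (w' '' A) := by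
  rw [Set.image_image]
  rfl

/-- Conjugation by `rep A` carries walls of `A` to walls of the fundamental alcove, so a reflection
from the left becomes a simple reflection from the right. -/
theorem edge_iff {A B : DomAlcove} : Edge A B ↔
    (∃ s, rep B = rep A * (simple s).equiv) ∧ length B.1 = length A.1 + 1 := by
  refine and_congr_left fun _ => ?_
  have hA := rep_mem A
  constructor
  · rintro ⟨t, ht, hB⟩
    obtain ⟨r, hr, -⟩ := exists_conj hA t
    have hwall : IsWall r (((rep A)⁻¹ : Space ≃ₗ[ℝ] Space) '' A.1) := by
      refine isWall_image (D.inv_mem hA) ?_ ht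
      rw [eq_inv_mul_iff_mul_eq, ← mul_assoc, ← hr, mul_assoc, mul_inv_cancel, mul_one]
    rw [image_rep A, ← image_mul, inv_mul_cancel] at hwall
    obtain ⟨s, rfl⟩ := exists_eq_simple_of_isWall (t := r) (by simpa using hwall)
    refine ⟨s, rep_eq (D.mul_mem hA (Refl.equiv_mem _)) ?_⟩
    rw [hB, image_rep A, ← image_mul, hr]
  · rintro ⟨s, hs⟩
    obtain ⟨t, ht, -⟩ := exists_conj (D.inv_mem hA) (simple s)
    have ht' : t.equiv * rep A = rep A * (simple s).equiv := by
      rw [← eq_mul_inv_iff_mul_eq, mul_assoc, ht, mul_inv_cancel_left]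
    refine ⟨t, ?_, ?_⟩
    · rw [image_rep A]
      exact isWall_image hA ht' (isWall_simple s)
    · rw [image_rep A, image_rep B, ← image_mul, ht', hs]

/-- 𝒟 acts from the left and commutes with right multiplication, so the orbit of an edge is its type
`s`. -/
theorem sameOrbit_iff {A B A' B' : DomAlcove} {s : Space ≃ₗ[ℝ] Space} (h : rep B = rep A * s) :
    SameOrbit A B A' B' ↔ rep B' = rep A' * s := by
  constructor
  · rintro ⟨g, hg, hA, hB⟩
    have hA' : rep A' = g * rep A := rep_eq (D.mul_mem hg (rep_mem A)) (by
      rw [hA, image_rep A, image_mul])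
    have hB' : rep B' = g * rep B := rep_eq (D.mul_mem hg (rep_mem B)) (by
      rw [hB, image_rep B, image_mul])
    rw [hA', hB', h, mul_assoc]
  · intro h'
    refine ⟨rep A' * (rep A)⁻¹, D.mul_mem (rep_mem A') (D.inv_mem (rep_mem A)), ?_, ?_⟩
    · rw [image_rep A, image_rep A', ← image_mul, inv_mul_cancel_right]
    · rw [image_rep B, image_rep B', ← image_mul, h, h', mul_assoc, inv_mul_cancel_left]

/-! ### Edges in terms of labels -/

/-- The smaller index of a simple reflection. -/
def lo (s : Option ℕ+) : ℕ+ := (simple s).i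

/-- The larger index of a simple reflection. -/
def hi (s : Option ℕ+) : ℕ+ := (simple s).j

theorem lo_ne_hi (s : Option ℕ+) : lo s ≠ hi s := (simple s).lt.ne

/-- An edge of type `s` starts at the label `a`. -/
def Down : Option ℕ+ → Finset ℕ+ → Prop
  | none, a => 1 ∉ a ∧ 2 ∉ a
  | some k, a => k ∈ a ∧ k + 1 ∉ a

/-- An edge of type `s` ends at the label `a`. -/
def Up : Option ℕ+ → Finset ℕ+ → Prop
  | none, a => 1 ∈ a ∧ 2 ∈ a
  | some k, a => k ∉ a ∧ k + 1 ∈ a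

theorem mem_toggle {s : Option ℕ+} {a : Finset ℕ+} {n : ℕ+} :
    n ∈ symmDiff a {lo s, hi s} ↔ ((n = lo s ∨ n = hi s) ∧ n ∉ a) ∨
      (n ≠ lo s ∧ n ≠ hi s ∧ n ∈ a) := by
  simp only [Finset.mem_symmDiff, Finset.mem_insert, Finset.mem_singleton]
  tauto

theorem lo_mem_toggle {s : Option ℕ+} {a : Finset ℕ+} :
    lo s ∈ symmDiff a {lo s, hi s} ↔ lo s ∉ a := by
  simp [mem_toggle]

theorem hi_mem_toggle {s : Option ℕ+} {a : Finset ℕ+} :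
    hi s ∈ symmDiff a {lo s, hi s} ↔ hi s ∉ a := by
  simp [mem_toggle]

theorem Down.up {s : Option ℕ+} {a : Finset ℕ+} (h : Down s a) :
    Up s (symmDiff a {lo s, hi s}) := by
  rcases s with - | k
  · exact ⟨lo_mem_toggle.2 h.1, hi_mem_toggle.2 h.2⟩
  · exact ⟨fun hm => lo_mem_toggle.1 hm h.1, hi_mem_toggle.2 h.2⟩

theorem Up.down {s : Option ℕ+} {a : Finset ℕ+} (h : Up s a) :
    Down s (symmDiff a {lo s, hi s}) := by
  rcases s with - | k
  · exact ⟨fun hm => lo_mem_toggle.1 hm h.1, fun hm => hi_mem_toggle.1 hm h.2⟩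
  · exact ⟨lo_mem_toggle.2 h.1, fun hm => hi_mem_toggle.1 hm h.2⟩

theorem Down.joined {s : Option ℕ+} {a : Finset ℕ+} (h : Down s a) :
    Joined (symmDiff a {lo s, hi s}) = Reconnect (Joined a) (lo s) (hi s) := by
  funext i j
  apply propext
  rcases s with - | k
  · exact joined_create h.1 h.2 rfl i j
  · exact joined_shift h.1 h.2 rfl i j

theorem Down.not_joined {s : Option ℕ+} {a : Finset ℕ+} (h : Down s a) :
    ¬ Joined a (lo s) (hi s) := by
  intro hJ
  rcases s with - | k
  · exact hJ.mem_or_mem.elim h.1 h.2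
  · rcases hJ with hJ | hJ
    · exact h.2 hJ.right_mem
    · exact lt_asymm hJ.lt (simple (some k)).lt

theorem Down.sum_toggle {s : Option ℕ+} {a : Finset ℕ+} (h : Down s a) :
    ∑ m ∈ symmDiff a {lo s, hi s}, ((m : ℕ) - 1) = ∑ m ∈ a, ((m : ℕ) - 1) + 1 := by
  rcases s with - | k
  · have e : symmDiff a {lo none, hi none} = insert 1 (insert 2 a) := by
      ext n
      rw [mem_toggle]
      simp only [lo, hi, simple, Finset.mem_insert]
      by_cases h1 : n = 1
      · simp [h1, h.1]
      by_cases h2 : n = 2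
      · simp [h2, h.2]
      · simp [h1, h2]
    rw [e, Finset.sum_insert (by simp [h.1]), Finset.sum_insert h.2]
    simp
    omega
  · have hne : k ≠ k + 1 := (PNat.lt_add_right k 1).ne
    have e : symmDiff a {lo (some k), hi (some k)} = insert (k + 1) (a.erase k) := by
      ext n
      rw [mem_toggle]
      simp only [lo, hi, simple, Finset.mem_insert, Finset.mem_erase]
      by_cases h1 : n = k
      · subst h1
        simp [h.1, hne]
      by_cases h2 : n = k + 1
      · simp [h2, h.2]
      · simp [h1, h2]
    rw [e, Finset.sum_insert (by simp [h.2]), ← Finset.add_sum_erase a _ h.1]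
    have := k.pos
    simp
    omega

/-- Multiplication from the right acts on the absolute values of the entries: `lo s` and `hi s`
change places, with a change of sign for `none`. The label moves only if this alters the set of
positive values. -/
theorem signed_mul_simple {w : Space ≃ₗ[ℝ] Space} {σ : Perm ℕ+} {a : Finset ℕ+}
    (h : Signed w σ a) (s : Option ℕ+) : ∃ a' : Finset ℕ+,
      Signed (w * (simple s).equiv) (swap (lo s) (hi s) * σ) a' ∧
      ((Down s a ∨ Up s a) → a' = symmDiff a {lo s, hi s}) ∧
      (¬ (Down s a ∨ Up s a) → a' = a) := by
  refine ⟨_, h.mul (simple s).signed, ?_⟩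
  have hmem : ∀ n, n ∈ a.map (swap (lo s) (hi s)).toEmbedding ↔ swap (lo s) (hi s) n ∈ a := by
    intro n
    rw [Finset.mem_map_equiv, Equiv.symm_swap]
  have hlo : swap (lo s) (hi s) (lo s) = hi s := Equiv.swap_apply_left _ _
  have hhi : swap (lo s) (hi s) (hi s) = lo s := Equiv.swap_apply_right _ _
  have hne := lo_ne_hi s
  constructor
  · intro hD
    ext n
    rw [mem_toggle, Finset.mem_symmDiff, hmem]
    by_cases h1 : n = lo s
    · subst h1
      rw [hlo]
      rcases s with - | k <;> simp_all [lo, hi, simple, Down, Up] <;> tauto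
    by_cases h2 : n = hi s
    · subst h2
      rw [hhi]
      rcases s with - | k <;> simp_all [lo, hi, simple, Down, Up] <;> tauto
    · rw [Equiv.swap_apply_of_ne_of_ne h1 h2]
      have h1' : n ≠ (simple s).i := h1
      have h2' : n ≠ (simple s).j := h2
      split_ifs <;> simp [h1, h2, h1', h2']
  · intro hD
    ext n
    rw [Finset.mem_symmDiff, hmem]
    by_cases h1 : n = lo s
    · subst h1
      rw [hlo]
      rcases s with - | k <;> simp_all [lo, hi, simple, Down, Up] <;> tauto
    by_cases h2 : n = hi s
    · subst h2
      rw [hhi]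
      rcases s with - | k <;> simp_all [lo, hi, simple, Down, Up] <;> tauto
    · rw [Equiv.swap_apply_of_ne_of_ne h1 h2]
      have h1' : n ≠ (simple s).i := h1
      have h2' : n ≠ (simple s).j := h2
      split_ifs <;> simp [h1', h2']

/-- If the label did not change, `A` and `B` would coincide and the reflection would be trivial. -/
theorem lab_of_rep_eq {A B : DomAlcove} {s : Option ℕ+} (h : rep B = rep A * (simple s).equiv) :
    (Down s (lab A) ∨ Up s (lab A)) ∧ lab B = symmDiff (lab A) {lo s, hi s} := by
  obtain ⟨a', ha', h1, h2⟩ := signed_mul_simple (signed_rep A) s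
  rw [← h] at ha'
  have hB := lab_eq ha'
  by_cases hD : Down s (lab A) ∨ Up s (lab A)
  · exact ⟨hD, hB.trans (h1 hD)⟩
  · exfalso
    have hAB : rep A = rep B := by rw [lab_injective ((hB.trans (h2 hD)).symm)]
    rw [← hAB] at h
    have h1 : (simple s).equiv = 1 := (mul_eq_left.1 h.symm)
    have hlt : lo s < hi s := (simple s).lt
    have h2 := (simple s).signed
    have h3 := Signed.one
    rw [h1] at h2
    have e1 := h2.apply_vMinus (lo s)
    have e2 := h3.apply_vMinus (lo s)
    have hs : swap (simple s).i (simple s).j (lo s) = hi s := Equiv.swap_apply_left _ _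
    rw [e2, hs] at e1
    have e1 : entry ∅ (lo s) =
        entry (if (simple s).neg then {(simple s).i, (simple s).j} else ∅) (hi s) := by
      exact_mod_cast e1
    have hlt' : (lo s : ℕ) < hi s := hlt
    have := (lo s).pos
    simp only [entry, Finset.notMem_empty, if_false] at e1
    split_ifs at e1 <;> omega

/-- The two entries that move do not pass each other or any other entry, so the sequence stays
descending and the neighbouring alcove is dominant. -/
theorem entry_toggle_lt {s : Option ℕ+} {a : Finset ℕ+} (h : Down s a ∨ Up s a) {m n : ℕ+}
    (hmn : entry a m < entry a n) :
    entry (symmDiff a {lo s, hi s}) (swap (lo s) (hi s) m) <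
      entry (symmDiff a {lo s, hi s}) (swap (lo s) (hi s) n) := by
  have hne := lo_ne_hi s
  have hlo : entry (symmDiff a {lo s, hi s}) (swap (lo s) (hi s) (lo s)) =
      if hi s ∈ a then -((hi s : ℕ) : ℤ) else (hi s : ℕ) := by
    rw [Equiv.swap_apply_left, entry]
    by_cases hh : hi s ∈ a <;> simp [mem_toggle, hh]
  have hhi : entry (symmDiff a {lo s, hi s}) (swap (lo s) (hi s) (hi s)) =
      if lo s ∈ a then -((lo s : ℕ) : ℤ) else (lo s : ℕ) := by
    rw [Equiv.swap_apply_right, entry]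
    by_cases hh : lo s ∈ a <;> simp [mem_toggle, hh]
  have hother : ∀ p, p ≠ lo s → p ≠ hi s →
      entry (symmDiff a {lo s, hi s}) (swap (lo s) (hi s) p) = entry a p := by
    intro p h1 h2
    rw [Equiv.swap_apply_of_ne_of_ne h1 h2, entry, entry]
    simp [mem_toggle, h1, h2]
  have hc : ∀ p : ℕ+, p = lo s ∨ p = hi s ∨
      (p ≠ lo s ∧ p ≠ hi s ∧ (p : ℕ) ≠ lo s ∧ (p : ℕ) ≠ hi s) := by
    intro p
    by_cases h1 : p = lo s
    · exact Or.inl h1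
    by_cases h2 : p = hi s
    · exact Or.inr (Or.inl h2)
    · exact Or.inr (Or.inr ⟨h1, h2, fun h => h1 (PNat.coe_injective h),
        fun h => h2 (PNat.coe_injective h)⟩)
  have hsmall : ∀ p : ℕ+, p ≠ lo s → p ≠ hi s →
      entry a p = (p : ℕ) ∨ entry a p = -((p : ℕ) : ℤ) := by
    intro p _ _
    unfold entry
    split_ifs <;> simp
  have hcases : ((lo s : ℕ) = 1 ∧ (hi s : ℕ) = 2 ∧ (lo s ∈ a ↔ hi s ∈ a)) ∨
      ((hi s : ℕ) = lo s + 1 ∧ (lo s ∈ a ↔ hi s ∉ a)) := by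
    rcases s with - | k
    · left
      simp only [lo, hi, simple, Down, Up] at h ⊢
      exact ⟨rfl, rfl, by tauto⟩
    · right
      simp only [lo, hi, simple, Down, Up] at h ⊢
      exact ⟨by simp, by tauto⟩
  have elo : entry a (lo s) = if lo s ∈ a then ((lo s : ℕ) : ℤ) else -((lo s : ℕ) : ℤ) := rfl
  have ehi : entry a (hi s) = if hi s ∈ a then ((hi s : ℕ) : ℤ) else -((hi s : ℕ) : ℤ) := rfl
  have p1 := (lo s).pos
  have p2 := m.pos
  have p3 := n.pos
  rcases hc m with rfl | rfl | ⟨m1, m2, m3, m4⟩ <;>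
    rcases hc n with rfl | rfl | ⟨n1, n2, n3, n4⟩ <;>
    (try have e1 := hother m m1 m2) <;> (try have e2 := hother n n1 n2) <;>
    (try have f1 := hsmall m m1 m2) <;> (try have f2 := hsmall n n1 n2) <;>
    by_cases hl : lo s ∈ a <;> by_cases hh : hi s ∈ a <;>
    simp only [hl, hh, if_true, if_false, not_true, not_false_iff, iff_true, iff_false, and_true,
      and_false, or_false, false_or] at hlo hhi elo ehi hcases <;> omega

theorem exists_neighbour {A : DomAlcove} {s : Option ℕ+} (h : Down s (lab A) ∨ Up s (lab A)) :
    ∃ B, rep B = rep A * (simple s).equiv := by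
  obtain ⟨a', ha', h1, -⟩ := signed_mul_simple (signed_rep A) s
  rw [h1 h] at ha'
  refine ⟨ofRep _ (D.mul_mem (rep_mem A) (Refl.equiv_mem _)) ?_, rep_ofRep _ _⟩
  intro i j hij
  have hA := strictAnti_rep A hij
  rw [(signed_rep A).apply_vMinus, (signed_rep A).apply_vMinus] at hA
  rw [ha'.apply_vMinus, ha'.apply_vMinus]
  have := entry_toggle_lt h (by exact_mod_cast hA)
  exact_mod_cast this

theorem mul_simple_mul_simple (w : Space ≃ₗ[ℝ] Space) (s : Option ℕ+) :
    w * (simple s).equiv * (simple s).equiv = w := by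
  rw [mul_assoc, show (simple s).equiv * (simple s).equiv = 1 from
    LinearEquiv.ext fun x => (simple s).map_involutive x, mul_one]

theorem length_of_down {A B : DomAlcove} {s : Option ℕ+} (h : rep B = rep A * (simple s).equiv)
    (hD : Down s (lab A)) : length B.1 = length A.1 + 1 := by
  rw [length_eq, length_eq, (lab_of_rep_eq h).2, hD.sum_toggle]

theorem down_iff_length {A B : DomAlcove} {s : Option ℕ+} (h : rep B = rep A * (simple s).equiv) :
    length B.1 = length A.1 + 1 ↔ Down s (lab A) := by
  refine ⟨fun hl => ?_, length_of_down h⟩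
  obtain ⟨hD | hU, hB⟩ := lab_of_rep_eq h
  · exact hD
  · have h' : rep A = rep B * (simple s).equiv := by rw [h, mul_simple_mul_simple]
    have := length_of_down h' (hB ▸ hU.down)
    omega

/-- Without a 01 at adjacent positions the set is an initial segment; being even and nonempty, it
contains 1 and 2. -/
theorem exists_up_of_ne_empty {a : Finset ℕ+} (he : Even a.card) (h : a ≠ ∅) : ∃ s, Up s a := by
  by_contra hc
  push Not at hc
  have hdown : ∀ k : ℕ+, k + 1 ∈ a → k ∈ a := by
    intro k hk
    by_contra hk'
    exact hc (some k) ⟨hk', hk⟩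
  have h1 : ∀ k : ℕ+, k ∈ a → 1 ∈ a := by
    intro k
    induction k using PNat.recOn with
    | one => exact id
    | succ k ih => exact fun hk => ih (hdown k hk)
  have h2 : ∀ k : ℕ+, k + 1 ∈ a → 2 ∈ a := by
    intro k
    induction k using PNat.recOn with
    | one => exact id
    | succ k ih => exact fun hk => ih (hdown (k + 1) hk)
  obtain ⟨k, hk⟩ := Finset.nonempty_iff_ne_empty.2 h
  have h1 := h1 k hk
  have : 1 < a.card := by
    have := Finset.card_pos.2 ⟨k, hk⟩
    rw [Nat.even_iff] at he
    omega
  obtain ⟨m, hm, hm1⟩ := Finset.exists_mem_ne this 1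
  obtain ⟨n, rfl⟩ := PNat.exists_eq_succ_of_ne_one hm1
  exact hc none ⟨h1, h2 n hm⟩

theorem exists_lab_eq {a : Finset ℕ+} (he : Even a.card) : ∃ A, lab A = a := by
  obtain ⟨d, hd⟩ : ∃ d, d = ∑ m ∈ a, ((m : ℕ) - 1) := ⟨_, rfl⟩
  induction d using Nat.strong_induction_on generalizing a with
  | _ d IH =>
    by_cases h : a = ∅
    · subst h
      have hv : StrictAnti ((1 : Space ≃ₗ[ℝ] Space) vMinus) :=
        (mem_fundAlcove.1 vMinus_mem_fundAlcove).1
      refine ⟨ofRep 1 D.one_mem hv, lab_eq (σ := 1) ?_⟩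
      rw [rep_ofRep]
      exact Signed.one
    · obtain ⟨s, hs⟩ := exists_up_of_ne_empty he h
      have hsum := hs.down.sum_toggle
      rw [symmDiff_symmDiff_cancel_right] at hsum
      obtain ⟨B, hB⟩ := IH _ (by omega) (a := symmDiff a {lo s, hi s})
        (even_card_symmDiff he (by rw [Finset.card_pair (lo_ne_hi s)]; exact even_two)) rfl
      obtain ⟨A, hA⟩ := exists_neighbour (A := B) (s := s) (Or.inl (hB ▸ hs.down))
      refine ⟨A, ?_⟩
      rw [(lab_of_rep_eq hA).2, hB, symmDiff_symmDiff_cancel_right]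

theorem exists_edge_iff {A : DomAlcove} : (∃ B, Edge B A) ↔ lab A ≠ ∅ := by
  constructor
  · rintro ⟨B, hB⟩ h
    have := hB.2
    rw [length_eq A, h] at this
    simp at this
  · intro h
    obtain ⟨s, hs⟩ := exists_up_of_ne_empty (even_card_lab A) h
    obtain ⟨B, hB⟩ := exists_neighbour (Or.inr hs)
    have hA : rep A = rep B * (simple s).equiv := by rw [hB, mul_simple_mul_simple]
    refine ⟨B, edge_iff.2 ⟨⟨s, hA⟩, length_of_down hA ?_⟩⟩
    rw [(lab_of_rep_eq hB).2]
    exact hs.down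

/-! ### The recursion -/

/-- The hypercube of `a`, as a row of the array of polynomials. -/
def hypercube (a b : Finset ℕ+) : ℤ[T;T⁻¹] := weight (Joined a) (symmDiff a b)

/-- The two sums together have at most one term, the neighbour of `E` of the type `s` of the edge.
The cases match how many of `lo s` and `hi s` lie in the difference `u` of the labels of `B` and
`E`. -/
theorem preRow_hypercube {A B : DomAlcove} (h : Edge B A) (E : DomAlcove) :
    preRow B A (fun E => hypercube (lab B) (lab E)) E = hypercube (lab A) (lab E) := by
  obtain ⟨⟨s, hs⟩, hl⟩ := edge_iff.1 h
  have hD := (down_iff_length hs).1 hl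
  have hA := (lab_of_rep_eq hs).2
  have hlow : {E' : DomAlcove | Edge E' E ∧ SameOrbit B A E' E} =
      {E' | rep E' = rep E * (simple s).equiv ∧ Up s (lab E)} := by
    ext E'
    simp only [Set.mem_ofPred_eq, sameOrbit_iff hs, edge_iff]
    constructor
    · rintro ⟨⟨-, hl⟩, h⟩
      have h' : rep E' = rep E * (simple s).equiv := by rw [h, mul_simple_mul_simple]
      refine ⟨h', ?_⟩
      rw [(lab_of_rep_eq h).2]
      exact ((down_iff_length h).1 hl).up
    · rintro ⟨h, hU⟩
      have h' : rep E = rep E' * (simple s).equiv := by rw [h, mul_simple_mul_simple]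
      refine ⟨⟨⟨s, h'⟩, length_of_down h' ?_⟩, h'⟩
      rw [(lab_of_rep_eq h).2]
      exact hU.down
  have hhigh : {E' : DomAlcove | Edge E E' ∧ SameOrbit B A E E'} =
      {E' | rep E' = rep E * (simple s).equiv ∧ Down s (lab E)} := by
    ext E'
    simp only [Set.mem_ofPred_eq, sameOrbit_iff hs, edge_iff]
    constructor
    · rintro ⟨⟨-, hl⟩, h⟩
      exact ⟨h, (down_iff_length h).1 hl⟩
    · rintro ⟨h, hU⟩
      exact ⟨⟨⟨s, h⟩, length_of_down h hU⟩, h⟩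
  have hsingle : ∀ E', rep E' = rep E * (simple s).equiv → ∀ P : Prop, P →
      {E' | rep E' = rep E * (simple s).equiv ∧ P} = {E'} := by
    intro E' h P hP
    ext F
    simp only [Set.mem_ofPred_eq, hP, and_true, Set.mem_singleton_iff, ← h]
    exact rep_injective.eq_iff
  have hempty : ∀ P : Prop, ¬ P →
      {E' | rep E' = rep E * (simple s).equiv ∧ P} = ∅ := by
    intro P hP
    ext F
    simp [hP]
  have hdisj : ∀ e, Down s e → ¬ Up s e := by
    intro e hd hu
    rcases s with - | k <;> exact absurd hu.1 (by simpa using hd.1)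
  have hM := isMatching_joined (lab B)
  have hxy := hD.not_joined
  have hne := lo_ne_hi s
  rw [preRow, hlow, hhigh]
  unfold hypercube
  rw [hA, hD.joined, symmDiff_right_comm]
  set u := symmDiff (lab B) (lab E) with hu
  have hmem : ∀ n, n ∈ u ↔ ¬ (n ∈ lab B ↔ n ∈ lab E) := by
    intro n
    rw [hu, Finset.mem_symmDiff]
    tauto
  have hins : lo s ∉ u → hi s ∉ u → symmDiff u {lo s, hi s} = insert (lo s) (insert (hi s) u) := by
    intro h1 h2
    ext n
    rw [mem_toggle]
    simp only [Finset.mem_insert]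
    by_cases e1 : n = lo s
    · simp [e1, h1]
    by_cases e2 : n = hi s
    · simp [e2, h2]
    · simp [e1, e2]
  -- Both lie in `u`: the toggled difference avoids them, and `weight_reconnect` applies.
  by_cases hUE : Up s (lab E)
  · obtain ⟨E', hE'⟩ := exists_neighbour (Or.inr hUE)
    have hlab := (lab_of_rep_eq hE').2
    have hDE : ¬ Down s (lab E) := fun h => hdisj _ h hUE
    rw [hsingle E' hE' _ hUE, hempty _ hDE, finsum_mem_singleton, finsum_mem_empty, add_zero, hlab,
      ← symmDiff_assoc, ← hu]
    have h1 : lo s ∉ symmDiff u {lo s, hi s} ∧ hi s ∉ symmDiff u {lo s, hi s} := by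
      rw [mem_toggle, mem_toggle, hmem, hmem]
      rcases s with - | k <;> simp_all [Down, Up, lo, hi, simple]
    have h2 : u = insert (lo s) (insert (hi s) (symmDiff u {lo s, hi s})) := by
      ext n
      simp only [Finset.mem_insert, mem_toggle]
      by_cases e1 : n = lo s
      · have := h1.1
        rw [mem_toggle] at this
        simp [e1] at this ⊢
        exact this
      by_cases e2 : n = hi s
      · have := h1.2
        rw [mem_toggle] at this
        simp [e2] at this ⊢
        exact this
      · simp [e1, e2]
    rw [weight_reconnect hM hxy h1.1 h1.2 hne, ← h2]
  -- Neither lies in `u`: `weight_reconnect_insert` applies.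
  by_cases hDE : Down s (lab E)
  · obtain ⟨E', hE'⟩ := exists_neighbour (Or.inl hDE)
    have hlab := (lab_of_rep_eq hE').2
    rw [hsingle E' hE' _ hDE, hempty _ hUE, finsum_mem_singleton, finsum_mem_empty, zero_add, hlab,
      ← symmDiff_assoc, ← hu]
    have h1 : lo s ∉ u ∧ hi s ∉ u := by
      rw [hmem, hmem]
      rcases s with - | k <;> simp_all [Down, Up, lo, hi, simple]
    rw [hins h1.1 h1.2, weight_reconnect_insert hM hxy h1.1 h1.2 hne]
  -- Exactly one lies in `u`: both sums are empty, and the toggled difference cuts the new pair.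
  · rw [hempty _ hUE, hempty _ hDE, finsum_mem_empty, finsum_mem_empty, add_zero, weight, if_neg]
    have h1 : (lo s ∈ u ∧ hi s ∉ u) ∨ (lo s ∉ u ∧ hi s ∈ u) := by
      rw [hmem, hmem]
      rcases s with - | k <;> simp only [Down, Up, lo, hi, simple] at hD hDE hUE ⊢ <;> tauto
    rcases h1 with ⟨h1, h2⟩ | ⟨h1, h2⟩
    · exact not_saturated_reconnect_right (by simp [mem_toggle, h1]) (by simp [mem_toggle, h2])
    · exact not_saturated_reconnect_left (by simp [mem_toggle, h1]) (by simp [mem_toggle, h2])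

theorem hypercube_empty (b : Finset ℕ+) : hypercube ∅ b = if b = ∅ then 1 else 0 := by
  unfold hypercube
  by_cases hb : b = ∅
  · subst hb
    rw [if_pos rfl, symmDiff_self, Finset.bot_eq_empty]
    rw [weight, if_pos (show Saturated _ _ from fun i hi => (Finset.notMem_empty i hi).elim)]
    simp
  · rw [if_neg hb, weight, if_neg]
    intro h
    obtain ⟨k, hk⟩ := Finset.nonempty_iff_ne_empty.2 hb
    obtain ⟨j, -, hj⟩ := h k (by simpa [Finset.mem_symmDiff] using hk)
    have := hj.mem_or_mem
    simp at this

theorem pKL_eq_hypercube (c : EdgeChoice) (A E : DomAlcove) :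
    pKL c A E = hypercube (lab A) (lab E) := by
  obtain ⟨d, hd⟩ : ∃ d, d = length A.1 := ⟨_, rfl⟩
  induction d using Nat.strong_induction_on generalizing A E with
  | _ d IH =>
    rw [pKL]
    by_cases h : ∃ B, Edge B A
    · rw [dif_pos h]
      have hB := (c A h).2
      have hrow : pKL c (c A h).1 = fun E => hypercube (lab (c A h).1) (lab E) :=
        funext fun E => IH _ (hd ▸ hB.length_lt) _ E rfl
      rw [hrow]
      simp only [preRow_hypercube hB]
      -- Each `F` below `A` is shorter, hence has a different label and constant coefficient zero.
      rw [finsum_eq_zero_of_forall_eq_zero, sub_zero]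
      rintro ⟨F, hF⟩
      have hne : lab A ≠ lab F := fun h => by
        have := hF.length_lt
        rw [lab_injective h] at this
        exact this.false
      have : (hypercube (lab A) (lab F)).coeff 0 = 0 := coeff_zero_weight hne
      simp [this]
    · rw [dif_neg h]
      have hA : lab A = ∅ := by
        by_contra hc
        exact h (exists_edge_iff.2 hc)
      rw [hA, hypercube_empty]
      by_cases hE : E = A
      · subst hE
        rw [if_pos hA, Pi.single_eq_same]
      · rw [if_neg fun h => hE (lab_injective (h.trans hA.symm)), Pi.single_eq_of_ne hE]

end

end DKL

/-- For every choice `c` of edges in the recursion: the labels identify the dominant alcoves with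
the finite subsets of `ℕ+` of even order, and under this identification `p_{a,b} = v ^ d` if `b`
appears in the hypercube `h^a` at depth `d`, and `p_{a,b} = 0` if `b` does not appear in `h^a`. -/
theorem mainTheorem4 (c : DKL.EdgeChoice) :
    (∀ A : DKL.DomAlcove, ∃ a : Finset ℕ+, Even a.card ∧ DKL.label A = (a : Set ℕ+)) ∧
    (∀ a : Finset ℕ+, Even a.card → ∃! A : DKL.DomAlcove, DKL.label A = (a : Set ℕ+)) ∧
    (∀ (A B : DKL.DomAlcove) (a b : Finset ℕ+),
      DKL.label A = (a : Set ℕ+) → DKL.label B = (b : Set ℕ+) →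
        (∀ d : ℕ, DKL.AtDepth a b d →
          DKL.pKL c A B = (LaurentPolynomial.T (d : ℤ) : LaurentPolynomial ℤ)) ∧
        ((¬ ∃ d : ℕ, DKL.AtDepth a b d) → DKL.pKL c A B = 0)) := by
  simp only [DKL.label_eq_lab, Finset.coe_inj]
  refine ⟨fun A => ⟨_, DKL.even_card_lab A, rfl⟩, fun a ha => ?_, ?_⟩
  · obtain ⟨A, hA⟩ := DKL.exists_lab_eq ha
    exact ⟨A, hA, fun B hB => DKL.lab_injective (hB.trans hA.symm)⟩
  · rintro A B a b rfl rfl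
    rw [DKL.pKL_eq_hypercube]
    exact ⟨fun d hd => hd.weight_eq, DKL.weight_eq_zero_of_not_atDepth⟩
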